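/- Let $G$ be a group acting by isometries on two geodesic metric spaces $(X_1,d_1)$ and $(X_2,d_2)$. Assume that both actions are proper, i.e. $\{g\in G: d_i(x,gx)\le r\}$ is finite for all $x\in X_i$ and $r\ge 0$, and that both have the contracting property defined below. Let $E(G)$ be the elliptic radical of $G$, i.e. its unique maximal finite normal subgroup. Let $H\le G$ be a confined subgroup with a confining subset disjoint from $E(G)$: there is a finite set $P\subseteq G\setminus\{1\}$ with $P\cap E(G)=\varnothing$ and $gHg^{-1}\cap P\ne\varnothing$ for every $g\in G$. Let $o_1\in X_1$, $o_2\in X_2$ be arbitrary basepoints, and let $\ell_{d_i}(g)=\lim_{n\to\infty} d_i(o_i,g^no_i)/n$ be the stable translation length. If $\ell_{d_1}(h)=\ell_{d_2}(h)$ for all $h\in H$, then $$\sup_{g,h\in G}\bigl|d_1(go_1,ho_1)-d_2(go_2,ho_2)\bigr|<\infty ,$$ and the orbit map $Go_1\to Go_2$, $go_1\mapsto go_2$ (well defined up to a bounded error) is a rough isometry: for any choice of its values it is a $(1,c)$-quasi-isometry for some $c\ge 0$. *Definitions.* For $Y\subseteq X$ and $x\in X$ let $\pi_Y(x)=\{y\in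 Y: d(x,y)\le d(x,Y)+1\}$. The set $Y$ is contracting if there is $C\ge 0$ such that $\mathrm{diam}\bigl(\bigcup_{x\in\alpha}\pi_Y(x)\bigr)\le C$ for every geodesic segment $\alpha$ in $X$ with $d(\alpha,Y)\ge C$. An element $h\in G$ is contracting if, for a basepoint $o\in X$, the orbit $\langle h\rangle o$ is contracting and $\mathbb Z\to X$, $n\mapsto h^no$, is a quasi-isometric embedding. Contracting elements $g,h$ are weakly independent if for every $r\ge 0$ the intersection of the closed $r$-neighbourhoods of $\langle g\rangle o$ and $\langle h\rangle o$ is bounded. The action has the contracting property if $G$ contains two weakly independent contracting elements; this does not depend on $o$. -/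

import Mathlib

open Filter Topology
open scoped NNReal

namespace MLS

/-! ### Metric notions -/

/-- `γ`, restricted to `[0, L]`, is a geodesic segment of length `L`. -/
def IsGeodesicSegment {X : Type*} [MetricSpace X] (γ : ℝ → X) (L : ℝ) : Prop :=
  0 ≤ L ∧ ∀ s ∈ Set.Icc (0 : ℝ) L, ∀ t ∈ Set.Icc (0 : ℝ) L, dist (γ s) (γ t) = |s - t|

/-- Any two points are the endpoints of a geodesic segment. -/
def IsGeodesicSpace (X : Type*) [MetricSpace X] : Prop :=
  ∀ x y : X, ∃ (γ : ℝ → X) (L : ℝ), IsGeodesicSegment γ L ∧ γ 0 = x ∧ γ L = y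

/-- The coarse closest point projection of the point `x` to `A`: the points of `A` whose distance
to `x` is at most `d(x, A) + 1`. It is defined without assuming that nearest points exist. -/
def proj {X : Type*} [MetricSpace X] (A : Set X) (x : X) : Set X :=
  {y | y ∈ A ∧ dist x y ≤ Metric.infDist x A + 1}

/-- `Y` is `C`-contracting: if a geodesic segment `α` satisfies `d(α, Y) ≥ C`, then the projection
of `α` to `Y` has diameter at most `C`. -/
def IsContractingWith {X : Type*} [MetricSpace X] (C : ℝ) (Y : Set X) : Prop :=
  ∀ (γ : ℝ → X) (L : ℝ), IsGeodesicSegment γ L →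
    (∀ t ∈ Set.Icc (0 : ℝ) L, ∀ y ∈ Y, C ≤ dist (γ t) y) →
    ∀ s ∈ Set.Icc (0 : ℝ) L, ∀ t ∈ Set.Icc (0 : ℝ) L,
      ∀ p ∈ proj Y (γ s), ∀ q ∈ proj Y (γ t), dist p q ≤ C

/-- `Y` is a contracting subset. -/
def IsContracting {X : Type*} [MetricSpace X] (Y : Set X) : Prop :=
  ∃ C : ℝ, 0 ≤ C ∧ IsContractingWith C Y

/-- `Y` and `Z` have `R`-bounded intersection for some gauge `R : [0, ∞) → [0, ∞)`: the
intersection of the closed `r`-neighbourhoods has diameter at most `R r`, for every `r ≥ 0`. -/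
def HasBoundedIntersection {X : Type*} [MetricSpace X] (Y Z : Set X) : Prop :=
  ∃ R : ℝ≥0 → ℝ≥0, ∀ r : ℝ≥0,
    ∀ x ∈ Metric.cthickening (r : ℝ) Y ∩ Metric.cthickening (r : ℝ) Z,
    ∀ y ∈ Metric.cthickening (r : ℝ) Y ∩ Metric.cthickening (r : ℝ) Z, dist x y ≤ R r

/-- `f` is a `(lam, c)`-quasi-isometric embedding. -/
def IsQuasiIsometricEmbedding {X Y : Type*} [MetricSpace X] [MetricSpace Y]
    (lam c : ℝ) (f : X → Y) : Prop :=
  1 ≤ lam ∧ 0 ≤ c ∧ ∀ x y : X,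
    1 / lam * dist x y - c ≤ dist (f x) (f y) ∧ dist (f x) (f y) ≤ lam * dist x y + c

/-- `f` is a `(lam, c)`-quasi-isometry: a quasi-isometric embedding with a quasi-inverse. -/
def IsQuasiIsometry {X Y : Type*} [MetricSpace X] [MetricSpace Y]
    (lam c : ℝ) (f : X → Y) : Prop :=
  IsQuasiIsometricEmbedding lam c f ∧
    ∃ (f' : Y → X) (B : ℝ), (∀ x, dist x (f' (f x)) ≤ B) ∧ (∀ y, dist y (f (f' y)) ≤ B)

/-- `f` is a rough isometry: a `(1, c)`-quasi-isometry for some `c ≥ 0`. -/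
def IsRoughIsometry {X Y : Type*} [MetricSpace X] [MetricSpace Y] (f : X → Y) : Prop :=
  ∃ c : ℝ, 0 ≤ c ∧ IsQuasiIsometry 1 c f

/-! ### Isometric group actions -/

/-- The action of `G` on `X` is (metrically) proper: `{g | d(o, g o) ≤ r}` is finite for every
point `o` and every `r`. -/
def IsProperAction (G X : Type*) [Group G] [MetricSpace X] [MulAction G X] : Prop :=
  ∀ (o : X) (r : ℝ), {g : G | dist o (g • o) ≤ r}.Finite

/-- The orbit `⟨h⟩ o`. -/
def cyclicOrbit {G X : Type*} [Group G] [MulAction G X] (o : X) (h : G) : Set X :=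
  Set.range fun n : ℤ => h ^ n • o

/-- `h` is a contracting element (with respect to the basepoint `o`). -/
def IsContractingElement {G X : Type*} [Group G] [MetricSpace X] [MulAction G X]
    (o : X) (h : G) : Prop :=
  IsContracting (cyclicOrbit o h) ∧
    ∃ lam c : ℝ, IsQuasiIsometricEmbedding lam c fun n : ℤ => h ^ n • o

/-- The action has the contracting property: there are two weakly independent contracting elements,
that is, contracting elements `g`, `h` for which `⟨g⟩ o` and `⟨h⟩ o` have bounded intersection.
For an isometric action on a geodesic space this does not depend on the basepoint `o`. -/
def HasContractingProperty (G X : Type*) [Group G] [MetricSpace X] [MulAction G X] : Prop :=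
  ∃ (o : X) (g h : G), IsContractingElement o g ∧ IsContractingElement o h ∧
    HasBoundedIntersection (cyclicOrbit o g) (cyclicOrbit o h)

/-- The stable translation length `ℓ(g) = lim d(o, gⁿ o) / n`. -/
noncomputable def stableLength {G X : Type*} [Group G] [MetricSpace X] [MulAction G X]
    (o : X) (g : G) : ℝ :=
  limUnder atTop fun n : ℕ => dist o (g ^ n • o) / n

/-- For an isometric action the limit defining the stable translation length exists. -/
theorem tendsto_stableLength {G X : Type*} [Group G] [MetricSpace X] [MulAction G X]
    [IsIsometricSMul G X] (o : X) (g : G) :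
    Tendsto (fun n : ℕ => dist o (g ^ n • o) / n) atTop (𝓝 (stableLength o g)) := by
  have hsub : Subadditive fun n : ℕ => dist o (g ^ n • o) := by
    intro m n
    calc dist o (g ^ (m + n) • o) ≤ dist o (g ^ m • o) + dist (g ^ m • o) (g ^ (m + n) • o) :=
          dist_triangle _ _ _
      _ = dist o (g ^ m • o) + dist o (g ^ n • o) := by
          rw [pow_add, mul_smul, dist_smul]
  have hbdd : BddBelow (Set.range fun n : ℕ => dist o (g ^ n • o) / n) := by
    refine ⟨0, ?_⟩
    rintro _ ⟨n, rfl⟩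
    positivity
  exact tendsto_nhds_limUnder ⟨_, hsub.tendsto_lim hbdd⟩

/-- `ρ : G o₁ → G o₂` is an orbit map `g o₁ ↦ g o₂`. As `g o₁` need not determine `g o₂`, this
means that `ρ` sends each point of `G o₁` to `g o₂` for some `g` representing that point. -/
def IsOrbitMap {G X₁ X₂ : Type*} [Group G] [MulAction G X₁] [MulAction G X₂] {o₁ : X₁} {o₂ : X₂}
    (ρ : MulAction.orbit G o₁ → MulAction.orbit G o₂) : Prop :=
  ∀ x : MulAction.orbit G o₁, ∃ g : G, (x : X₁) = g • o₁ ∧ (ρ x : X₂) = g • o₂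

/-! ### The elliptic radical and confined subgroups -/

/-- The subgroup generated by all finite normal subgroups of `G`. -/
def ellipticRadical (G : Type*) [Group G] : Subgroup G :=
  sSup {N : Subgroup G | N.Normal ∧ Finite N}

/-- If `G` has a largest finite normal subgroup, then this is the elliptic radical. -/
theorem ellipticRadical_eq_of_isGreatest {G : Type*} [Group G] {E : Subgroup G}
    (hE : IsGreatest {N : Subgroup G | N.Normal ∧ Finite N} E) : ellipticRadical G = E :=
  hE.isLUB.sSup_eq

/-- `P` is a confining subset for `H`: a finite subset of `G \ {1}` that meets every conjugate
`g H g⁻¹`. The subgroup `H` is confined if it has a confining subset. -/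
def IsConfiningSubset {G : Type*} [Group G] (H : Subgroup G) (P : Set G) : Prop :=
  P.Finite ∧ (1 : G) ∉ P ∧ ∀ g : G, ∃ h ∈ H, g * h * g⁻¹ ∈ P

end MLS

namespace MLS

/-! ### Geodesics and projections to contracting sets -/

section Geometry

variable {X : Type*} [MetricSpace X]

/-! The core is `exists_confined_stableLength_ge`: for every `g` there are `a`, `b` in a fixed
finite set with `g a g⁻¹ b ∈ H` and stable length at least `2 d(o, g o)` up to a constant. In the
other action this stable length is at most the displacement of `g a g⁻¹ b`, hence at most `2 d'(o',
g o')` up to a constant. Equality on `H` bounds `d(o, g o)` by `d'(o', g o')` plus a constant;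
exchanging the actions gives the theorem.

Confinement gives membership in `H`: two conjugates of elements of `P` lying in `H` multiply to such
a word. The difficulty is to prevent backtracking. Let `f` be contracting. Geodesics between points
with distant projections to the axis `⟨f⟩ o` pass near both projections, and translates of the axis
by elements outside `axisStabilizer f` have bounded projections. This yields a Behrstock inequality,
and lengths almost add up along a product whose consecutive letters project far apart
(`IsBarrier.chain_step`).

The letters from `P` must therefore leave the stabilizer. It is virtually cyclic with finite normal
core, so the core lies in the elliptic radical and misses `P`; a single conjugation then moves all
of `P` out (`IsBarrier.exists_conj_notMem`). Conjugating by a large power of `f` pushes their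
projections far from `o`, while `IsBarrier.exists_extension` alters `g` by bounded factors to a `t`
for which `t o` and `t⁻¹ o` project near `o`. Near and far projections thus alternate along `t a t⁻¹
a'`. -/

theorem proj_nonempty {A : Set X} (hA : A.Nonempty) (x : X) : (proj A x).Nonempty := by
  obtain ⟨y, hy, h⟩ := (Metric.infDist_lt_iff hA).1 (lt_add_one (Metric.infDist x A))
  exact ⟨y, hy, h.le⟩

theorem dist_le_of_mem_proj {A : Set X} {x p y : X} (hp : p ∈ proj A x) (hy : y ∈ A) :
    dist x p ≤ dist x y + 1 :=
  hp.2.trans (by linarith [Metric.infDist_le_dist_of_mem (x := x) hy])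

/-- A continuous function reaching the level `D` has a last such time. -/
theorem exists_last_hit {φ : ℝ → ℝ} {a b D : ℝ} (hab : a ≤ b)
    (hφ : ContinuousOn φ (Set.Icc a b)) (ha : φ a ≤ D) (hb : D ≤ φ b) :
    ∃ s ∈ Set.Icc a b, φ s = D ∧ ∀ r ∈ Set.Icc s b, D ≤ φ r := by
  have hne : (Set.Icc a b ∩ φ ⁻¹' {D}).Nonempty := by
    obtain ⟨s, hs, h⟩ := intermediate_value_Icc hab hφ ⟨ha, hb⟩
    exact ⟨s, hs, h⟩
  have hcpt : IsCompact (Set.Icc a b ∩ φ ⁻¹' {D}) :=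
    isCompact_Icc.of_isClosed_subset
      (hφ.preimage_isClosed_of_isClosed isClosed_Icc isClosed_singleton) Set.inter_subset_left
  obtain ⟨s, ⟨hs, hsD⟩, hmax⟩ := hcpt.exists_isGreatest hne
  refine ⟨s, hs, hsD, fun r hr => ?_⟩
  by_contra! hlt
  obtain ⟨r', hr', h'⟩ := intermediate_value_Icc hr.2
    (hφ.mono (Set.Icc_subset_Icc_left (hs.1.trans hr.1))) ⟨hlt.le, hb⟩
  have h1 : r' ≤ s := hmax ⟨⟨(hs.1.trans hr.1).trans hr'.1, hr'.2⟩, h'⟩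
  have h2 : r = s := le_antisymm (hr'.1.trans h1) hr.1
  rw [h2, show φ s = D from hsD] at hlt
  exact lt_irrefl _ hlt

/-- A continuous function reaching the level `D` has a first such time. -/
theorem exists_first_hit {φ : ℝ → ℝ} {a b D : ℝ} (hab : a ≤ b)
    (hφ : ContinuousOn φ (Set.Icc a b)) (ha : D ≤ φ a) (hb : φ b ≤ D) :
    ∃ s ∈ Set.Icc a b, φ s = D ∧ ∀ r ∈ Set.Icc a s, D ≤ φ r := by
  obtain ⟨s, hs, h1, h2⟩ := exists_last_hit (φ := fun t => φ (-t)) (neg_le_neg hab)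
    (hφ.comp continuous_neg.continuousOn fun t ht => ⟨by linarith [ht.2], by linarith [ht.1]⟩)
    (D := D) (by simpa using hb) (by simpa using ha)
  refine ⟨-s, ⟨by linarith [hs.2], by linarith [hs.1]⟩, h1, fun r hr => ?_⟩
  simpa using h2 (-r) ⟨by linarith [hr.2], by linarith [hr.1]⟩

theorem IsGeodesicSegment.continuousOn {γ : ℝ → X} {L : ℝ} (hγ : IsGeodesicSegment γ L) :
    ContinuousOn γ (Set.Icc 0 L) := by
  refine (LipschitzOnWith.of_dist_le_mul (K := 1) fun s hs t ht => ?_).continuousOn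
  rw [hγ.2 s hs t ht, Real.dist_eq]
  simp

theorem IsGeodesicSegment.continuousOn_infDist {γ : ℝ → X} {L : ℝ} (hγ : IsGeodesicSegment γ L)
    (Y : Set X) : ContinuousOn (fun t => Metric.infDist (γ t) Y) (Set.Icc 0 L) :=
  (Metric.continuous_infDist_pt Y).comp_continuousOn hγ.continuousOn

variable {C : ℝ} {Y : Set X}

theorem IsContractingWith.dist_proj_le (hY : IsContractingWith C Y) {γ : ℝ → X} {L a b : ℝ}
    (hγ : IsGeodesicSegment γ L) (ha : 0 ≤ a) (hab : a ≤ b) (hb : b ≤ L)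
    (hfar : ∀ t ∈ Set.Icc a b, C ≤ Metric.infDist (γ t) Y) {p q : X}
    (hp : p ∈ proj Y (γ a)) (hq : q ∈ proj Y (γ b)) : dist p q ≤ C := by
  refine hY (fun t => γ (a + t)) (b - a) ⟨by linarith, fun s hs t ht => ?_⟩ (fun t ht y hy => ?_)
    0 ⟨le_rfl, by linarith⟩ (b - a) ⟨by linarith, le_rfl⟩ p (by simpa using hp) q (by simpa using hq)
  · rw [hγ.2 _ ⟨by linarith [hs.1], by linarith [hs.2]⟩ _ ⟨by linarith [ht.1], by linarith [ht.2]⟩]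
    congr 1
    ring
  · exact (hfar _ ⟨by linarith [ht.1], by linarith [ht.2]⟩).trans
      (Metric.infDist_le_dist_of_mem hy)

/-- A geodesic between two points with distant projections to a contracting set passes
near both projections. -/
theorem IsContractingWith.exists_near_proj (hY : IsContractingWith C Y) (hC : 0 ≤ C)
    {γ : ℝ → X} {L : ℝ} (hγ : IsGeodesicSegment γ L) {p q : X}
    (hp : p ∈ proj Y (γ 0)) (hq : q ∈ proj Y (γ L)) (hpq : C < dist p q) :
    ∃ s t, 0 ≤ s ∧ s ≤ t ∧ t ≤ L ∧ Metric.infDist (γ s) Y ≤ C ∧ Metric.infDist (γ t) Y ≤ C ∧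
      dist (γ s) p ≤ 2 * C + 1 ∧ dist (γ t) q ≤ 2 * C + 1 := by
  have hne : Y.Nonempty := ⟨p, hp.1⟩
  have hφ := hγ.continuousOn_infDist Y
  obtain ⟨r, hr, hrC⟩ : ∃ r ∈ Set.Icc 0 L, Metric.infDist (γ r) Y < C := by
    by_contra! h
    exact absurd (hY.dist_proj_le hγ le_rfl hγ.1 le_rfl h hp hq) (not_le.2 hpq)
  -- `s` is the first time at distance `C` from `Y`, or `0` if the segment starts closer. Until then
  -- projections move by at most `C`, and `γ s` is within `C + 1` of its own.
  obtain ⟨s, hs0, hsr, hsC, hsp⟩ : ∃ s, 0 ≤ s ∧ s ≤ r ∧ Metric.infDist (γ s) Y ≤ C ∧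
      dist (γ s) p ≤ 2 * C + 1 := by
    rcases le_total (Metric.infDist (γ 0) Y) C with h | h
    · exact ⟨0, le_rfl, hr.1, h, by linarith [hp.2]⟩
    · obtain ⟨s, hs, h1, h2⟩ := exists_first_hit hr.1 (hφ.mono (Set.Icc_subset_Icc_right hr.2))
        h hrC.le
      obtain ⟨p', hp'⟩ := proj_nonempty hne (γ s)
      have h3 := hY.dist_proj_le hγ le_rfl hs.1 (hs.2.trans hr.2) h2 hp hp'
      have h4 := hp'.2
      exact ⟨s, hs.1, hs.2, h1.le, by
        linarith [dist_triangle (γ s) p' p, dist_comm p p']⟩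
  obtain ⟨t, hrt, htL, htC, htq⟩ : ∃ t, r ≤ t ∧ t ≤ L ∧ Metric.infDist (γ t) Y ≤ C ∧
      dist (γ t) q ≤ 2 * C + 1 := by
    rcases le_total (Metric.infDist (γ L) Y) C with h | h
    · exact ⟨L, hr.2, le_rfl, h, by linarith [hq.2]⟩
    · obtain ⟨t, ht, h1, h2⟩ := exists_last_hit hr.2 (hφ.mono (Set.Icc_subset_Icc_left hr.1))
        hrC.le h
      obtain ⟨q', hq'⟩ := proj_nonempty hne (γ t)
      have h3 := hY.dist_proj_le hγ (hr.1.trans ht.1) ht.2 le_rfl h2 hq' hq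
      have h4 := hq'.2
      exact ⟨t, ht.1, ht.2, h1.le, by linarith [dist_triangle (γ t) q' q]⟩
  exact ⟨s, t, hs0, hsr.trans hrt, htL, hsC, htC, hsp, htq⟩

/-- Points with distant projections to a contracting set are joined through the projections,
up to a bounded error. -/
theorem IsContractingWith.dist_proj_add_le (hX : IsGeodesicSpace X) (hY : IsContractingWith C Y)
    (hC : 0 ≤ C) {x y p q : X} (hp : p ∈ proj Y x) (hq : q ∈ proj Y y) (hpq : C < dist p q) :
    dist x p + dist p q + dist q y ≤ dist x y + (8 * C + 4) := by
  obtain ⟨γ, L, hγ, rfl, rfl⟩ := hX x y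
  obtain ⟨s, t, hs, hst, ht, -, -, h1, h2⟩ := hY.exists_near_proj hC hγ hp hq hpq
  have hL := hγ.1
  have e1 := hγ.2 0 ⟨le_rfl, hL⟩ s ⟨hs, by linarith⟩
  have e2 := hγ.2 s ⟨hs, by linarith⟩ t ⟨by linarith, ht⟩
  have e3 := hγ.2 t ⟨by linarith, ht⟩ L ⟨hL, le_rfl⟩
  have e4 := hγ.2 0 ⟨le_rfl, hL⟩ L ⟨hL, le_rfl⟩
  rw [abs_of_nonpos (by linarith)] at e1 e2 e3 e4
  -- Replacing `p`, `q` by `γ s`, `γ t` costs `2 * C + 1` four times.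
  have t1 := dist_triangle (γ 0) (γ s) p
  have t2 := dist_triangle4 p (γ s) (γ t) q
  have t3 := dist_triangle q (γ t) (γ L)
  rw [dist_comm p (γ s)] at t2
  rw [dist_comm q (γ t)] at t3
  linarith

/-- Contracting sets are quasiconvex. -/
theorem IsContractingWith.infDist_le (hY : IsContractingWith C Y) (hne : Y.Nonempty)
    {γ : ℝ → X} {L a b t : ℝ} (hγ : IsGeodesicSegment γ L) (ha0 : 0 ≤ a) (hbL : b ≤ L)
    (ha : Metric.infDist (γ a) Y ≤ C) (hb : Metric.infDist (γ b) Y ≤ C)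
    (ht : t ∈ Set.Icc a b) : Metric.infDist (γ t) Y ≤ 4 * C + 2 := by
  have hφ := hγ.continuousOn_infDist Y
  have hC : 0 ≤ C := Metric.infDist_nonneg.trans ha
  rcases le_total (Metric.infDist (γ t) Y) C with h | h
  · linarith
  -- The excursion `[s, r]` around `t` beyond distance `C` has length at most `(C + 1) + C + (C +
  -- 1)`, through the projections of its endpoints.
  obtain ⟨s, hs, hs1, hs2⟩ := exists_last_hit ht.1
    (hφ.mono (Set.Icc_subset_Icc ha0 (ht.2.trans hbL))) ha h
  obtain ⟨r, hr, hr1, hr2⟩ := exists_first_hit ht.2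
    (hφ.mono (Set.Icc_subset_Icc (ha0.trans ht.1) hbL)) h hb
  obtain ⟨p, hp⟩ := proj_nonempty hne (γ s)
  obtain ⟨q, hq⟩ := proj_nonempty hne (γ r)
  have h1 := hY.dist_proj_le hγ (ha0.trans hs.1) (hs.2.trans hr.1) (hr.2.trans hbL)
    (fun u hu => (le_total u t).elim (fun h => hs2 u ⟨hu.1, h⟩) fun h => hr2 u ⟨h, hu.2⟩) hp hq
  have h2 := hγ.2 s ⟨ha0.trans hs.1, by linarith [hs.2, ht.2]⟩ r
    ⟨by linarith [hr.1, ht.1], hr.2.trans hbL⟩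
  have h3 := hγ.2 t ⟨ha0.trans ht.1, by linarith [ht.2]⟩ s
    ⟨ha0.trans hs.1, by linarith [hs.2, ht.2]⟩
  rw [abs_of_nonpos (by linarith [hs.2, hr.1])] at h2
  rw [abs_of_nonneg (by linarith [hs.2])] at h3
  have h4 := dist_triangle4 (γ s) p q (γ r)
  have h5 := hp.2
  have h6 := hq.2
  rw [dist_comm (γ r)] at h6
  have h7 := Metric.infDist_le_infDist_add_dist (s := Y) (x := γ t) (y := γ s)
  linarith [hr.1]

end Geometry

/-! ### Stable translation length -/

section StableLength

variable {G X : Type*} [Group G] [MetricSpace X] [MulAction G X] [IsIsometricSMul G X]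

theorem dist_smul_left_eq (g : G) (x y : X) : dist (g • x) y = dist x (g⁻¹ • y) := by
  rw [← dist_smul g x, smul_inv_smul]

/-- The additive error `D` disappears after division by `n`, while the linear drift `c * n`
survives. -/
theorem stableLength_le_add_of_le {X' : Type*} [MetricSpace X'] [MulAction G X']
    [IsIsometricSMul G X'] {o : X} {o' : X'} {g g' : G} {c D : ℝ}
    (h : ∀ n : ℕ, c * n + dist o (g ^ n • o) ≤ dist o' (g' ^ n • o') + D) :
    c + stableLength o g ≤ stableLength o' g' := by
  have h1 := (tendsto_stableLength o g).const_add c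
  have h2 := (tendsto_stableLength o' g').add (tendsto_const_div_atTop_nhds_zero_nat D)
  rw [add_zero] at h2
  refine le_of_tendsto_of_tendsto h1 h2 ?_
  filter_upwards [eventually_gt_atTop 0] with n hn
  have hn' : (0 : ℝ) < n := by exact_mod_cast hn
  rw [← add_div, ← sub_nonneg]
  have := h n
  have e : (dist o' (g' ^ n • o') + D) / n - (c + dist o (g ^ n • o) / n) =
      (dist o' (g' ^ n • o') + D - (c * n + dist o (g ^ n • o))) / n := by
    field_simp
  rw [e]
  exact div_nonneg (by linarith) hn'.le

theorem le_stableLength_of_le {o : X} {g : G} {c D : ℝ}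
    (h : ∀ n : ℕ, c * n ≤ dist o (g ^ n • o) + D) : c ≤ stableLength o g := by
  have h0 : stableLength o (1 : G) = 0 :=
    tendsto_nhds_unique (tendsto_stableLength o (1 : G)) (by simp)
  have := stableLength_le_add_of_le (o := o) (o' := o) (g := 1) (g' := g) (c := c) (D := D)
    (fun n => by simpa using h n)
  linarith

theorem stableLength_le_dist (o : X) (g : G) : stableLength o g ≤ dist o (g • o) := by
  refine le_of_tendsto' (tendsto_stableLength o g) fun n => ?_
  refine div_le_of_le_mul₀ n.cast_nonneg dist_nonneg ?_
  induction n with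
  | zero => simp
  | succ n ih =>
    have := dist_triangle o (g • o) (g ^ (n + 1) • o)
    rw [pow_succ', mul_smul, dist_smul] at this
    rw [pow_succ', mul_smul]
    push_cast
    linarith

theorem stableLength_basepoint_le (o o' : X) (g : G) : stableLength o g ≤ stableLength o' g := by
  have := stableLength_le_add_of_le (o := o) (o' := o') (g := g) (g' := g) (c := 0)
    (D := 2 * dist o o') fun n => by
      have := dist_triangle4 o o' (g ^ n • o') (g ^ n • o)
      rw [dist_smul, dist_comm o' o] at this
      linarith
  linarith

theorem stableLength_basepoint (o o' : X) (g : G) : stableLength o g = stableLength o' g :=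
  le_antisymm (stableLength_basepoint_le o o' g) (stableLength_basepoint_le o' o g)

theorem stableLength_conj (o : X) (x g : G) :
    stableLength o (x * g * x⁻¹) = stableLength o g := by
  refine Eq.trans ?_ (stableLength_basepoint (x⁻¹ • o) o g)
  unfold stableLength
  congr 1
  ext n
  rw [conj_pow, mul_smul, mul_smul, dist_comm, dist_smul_left_eq, dist_comm]

theorem dist_zpow_natAbs (o : X) (g : G) (n : ℤ) :
    dist o (g ^ n.natAbs • o) = dist o (g ^ n • o) := by
  rcases Int.natAbs_eq n with h | h
  · conv_rhs => rw [h]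
    rw [zpow_natCast]
  · conv_rhs => rw [h]
    rw [zpow_neg, zpow_natCast, dist_comm, dist_smul_left_eq]

theorem stableLength_zpow (o : X) (g : G) (a : ℤ) :
    stableLength o (g ^ a) = a.natAbs * stableLength o g := by
  rcases eq_or_ne a 0 with rfl | ha
  · simp only [zpow_zero, Int.natAbs_zero, Nat.cast_zero, zero_mul]
    exact tendsto_nhds_unique (tendsto_stableLength o (1 : G)) (by simp)
  · have hpos : 0 < a.natAbs := Int.natAbs_pos.2 ha
    refine tendsto_nhds_unique (tendsto_stableLength o (g ^ a)) ?_
    have h1 := ((tendsto_stableLength o g).comp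
      (tendsto_id.const_mul_atTop' hpos)).const_mul (a.natAbs : ℝ)
    refine h1.congr fun n => ?_
    have e : dist o ((g ^ a) ^ n • o) = dist o (g ^ (a.natAbs * n) • o) := by
      rw [← zpow_natCast, ← zpow_mul, ← dist_zpow_natAbs, Int.natAbs_mul, Int.natAbs_natCast]
    simp only [Function.comp_apply, id_eq, e]
    push_cast
    have : (a.natAbs : ℝ) ≠ 0 := by exact_mod_cast hpos.ne'
    rcases eq_or_ne n 0 with rfl | hn
    · simp
    · field_simp

theorem stableLength_pos_of_quasiIsometricEmbedding {o : X} {f : G} {lam c : ℝ}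
    (hf : IsQuasiIsometricEmbedding lam c fun n : ℤ => f ^ n • o) : 0 < stableLength o f := by
  refine (one_div_pos.2 (zero_lt_one.trans_le hf.1)).trans_le
    (le_stableLength_of_le (D := c) fun n => ?_)
  have := (hf.2.2 0 n).1
  simp only [zpow_zero, one_smul, zpow_natCast, Int.dist_eq, Int.cast_zero, Int.cast_natCast,
    zero_sub, abs_neg, Nat.abs_cast] at this
  linarith

/-- Stable length is conjugation invariant and homogeneous in the exponent, so a positive value
detects `|a|`. -/
theorem natAbs_eq_of_conj_zpow {o : X} {f : G} (hf : 0 < stableLength o f) {x : G} {a b : ℤ}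
    (h : x * f ^ a * x⁻¹ = f ^ b) : a.natAbs = b.natAbs := by
  have h1 := stableLength_conj o x (f ^ a)
  rw [h, stableLength_zpow, stableLength_zpow] at h1
  exact_mod_cast (mul_right_cancel₀ hf.ne' h1).symm

end StableLength

/-! ### The stabilizer of the axis, algebraically -/

section AxisStabilizer

/-- The elements that conjugate a nontrivial power of `f` to itself or to its inverse. -/
def axisStabilizer {G : Type*} [Group G] (f : G) : Subgroup G where
  carrier := {x | ∃ n : ℤ, n ≠ 0 ∧ ∃ ε : ℤˣ, x * f ^ n * x⁻¹ = f ^ (ε * n)}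
  one_mem' := ⟨1, one_ne_zero, 1, by simp⟩
  mul_mem' := by
    rintro x y ⟨m, hm, ε, hx⟩ ⟨n, hn, δ, hy⟩
    refine ⟨m * n, mul_ne_zero hm hn, ε * δ, ?_⟩
    have hx' : x * f ^ (m * (δ * n)) * x⁻¹ = f ^ (ε * m * (δ * n)) := by
      rw [zpow_mul, ← conj_zpow, hx, ← zpow_mul]
    have hy' : y * f ^ (n * m) * y⁻¹ = f ^ (δ * n * m) := by
      rw [zpow_mul, ← conj_zpow, hy, ← zpow_mul]
    calc x * y * f ^ (m * n) * (x * y)⁻¹ = x * (y * f ^ (n * m) * y⁻¹) * x⁻¹ := by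
          rw [mul_comm m n]; group
      _ = _ := by
          rw [hy', show (δ : ℤ) * n * m = m * (δ * n) by ring, hx']
          congr 1
          push_cast
          ring
  inv_mem' := by
    rintro x ⟨n, hn, ε, hx⟩
    refine ⟨n, hn, ε, ?_⟩
    have hx' : x * f ^ (n * ε) * x⁻¹ = f ^ (ε * n * ε) := by
      rw [zpow_mul, ← conj_zpow, hx, ← zpow_mul]
    rw [show (ε : ℤ) * n * ε = n by
      rw [mul_right_comm, ← Units.val_mul, Int.units_mul_self]; simp] at hx'
    rw [← hx', mul_comm (n : ℤ)]
    group

variable {G : Type*} [Group G] {f : G}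

theorem exists_conj_zpow_mul {x : G} (hx : x ∈ axisStabilizer f) :
    ∃ n : ℤ, n ≠ 0 ∧ ∃ ε : ℤˣ, ∀ k : ℤ, x * f ^ (n * k) * x⁻¹ = f ^ (ε * (n * k)) := by
  obtain ⟨n, hn, ε, h⟩ := hx
  refine ⟨n, hn, ε, fun k => ?_⟩
  rw [zpow_mul, ← conj_zpow, h, ← zpow_mul, mul_assoc]

theorem zpow_mem_axisStabilizer (k : ℤ) : f ^ k ∈ axisStabilizer f :=
  ⟨1, one_ne_zero, 1, by
    rw [Units.val_one, one_mul, ← zpow_neg, ← zpow_add, ← zpow_add]; congr 1; ring⟩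

end AxisStabilizer

/-! ### Translates of a contracting orbit -/

section CyclicOrbit

variable {G X : Type*} [Group G] [MulAction G X] {o : X} {f : G}

theorem zpow_smul_mem_cyclicOrbit (o : X) (f : G) (n : ℤ) : f ^ n • o ∈ cyclicOrbit o f := ⟨n, rfl⟩

theorem self_mem_cyclicOrbit (o : X) (f : G) : o ∈ cyclicOrbit o f := ⟨0, by simp⟩

variable [MetricSpace X] [IsIsometricSMul G X]

theorem zpow_smul_mem_proj {x p : X} (k : ℤ) (hp : p ∈ proj (cyclicOrbit o f) x) :
    f ^ k • p ∈ proj (cyclicOrbit o f) (f ^ k • x) := by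
  obtain ⟨⟨n, rfl⟩, h⟩ := hp
  refine ⟨⟨k + n, by simp only [zpow_add, mul_smul]⟩, ?_⟩
  rw [dist_smul]
  refine h.trans (add_le_add_left ?_ 1)
  rw [Metric.le_infDist ⟨o, self_mem_cyclicOrbit o f⟩]
  rintro _ ⟨m, rfl⟩
  refine (Metric.infDist_le_dist_of_mem (zpow_smul_mem_cyclicOrbit o f (-k + m))).trans_eq ?_
  rw [zpow_add, mul_smul, dist_comm, zpow_neg, dist_smul_left_eq, inv_inv, dist_comm]

theorem IsGeodesicSegment.smul {γ : ℝ → X} {L : ℝ} (hγ : IsGeodesicSegment γ L) (g : G) :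
    IsGeodesicSegment (fun t => g • γ t) L :=
  ⟨hγ.1, fun s hs t ht => by rw [dist_smul, hγ.2 s hs t ht]⟩

/-- If a translate of a contracting orbit has a large projection, then a long geodesic is close
to both. -/
theorem exists_fellow_geodesic (hX : IsGeodesicSpace X) {C : ℝ} (hC : 0 ≤ C)
    (hA : IsContractingWith C (cyclicOrbit o f)) {g : G} {x y p q : X}
    (hx : x ∈ cyclicOrbit o f) (hy : y ∈ cyclicOrbit o f)
    (hp : p ∈ proj (cyclicOrbit o f) (g • x)) (hq : q ∈ proj (cyclicOrbit o f) (g • y))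
    (hpq : C < dist p q) :
    ∃ (γ : ℝ → X) (M : ℝ), dist p q ≤ M + (4 * C + 2) ∧ IsGeodesicSegment γ M ∧
      ∀ t ∈ Set.Icc 0 M, ∃ m n : ℤ, dist (γ t) (f ^ m • o) ≤ 4 * C + 3 ∧
        dist (γ t) (g • f ^ n • o) ≤ 4 * C + 3 := by
  obtain ⟨γ, L, hγ, h0, hL⟩ := hX (g • x) (g • y)
  rw [← h0] at hp
  rw [← hL] at hq
  obtain ⟨s, t, hs, hst, ht, hs', ht', h1, h2⟩ := hA.exists_near_proj hC hγ hp hq hpq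
  have hne : (cyclicOrbit o f).Nonempty := ⟨o, self_mem_cyclicOrbit o f⟩
  refine ⟨fun u => γ (s + u), t - s, ?_, ⟨by linarith, fun u hu v hv => ?_⟩, fun u hu => ?_⟩
  · have h3 := hγ.2 s ⟨hs, by linarith⟩ t ⟨by linarith, ht⟩
    rw [abs_of_nonpos (by linarith)] at h3
    have h4 := dist_triangle4 p (γ s) (γ t) q
    rw [dist_comm p (γ s)] at h4
    linarith
  · rw [hγ.2 _ ⟨by linarith [hu.1], by linarith [hu.2]⟩ _ ⟨by linarith [hv.1], by linarith [hv.2]⟩]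
    congr 1
    ring
  · have h3 := hA.infDist_le hne hγ hs ht hs' ht' (t := s + u)
      ⟨by linarith [hu.1], by linarith [hu.2]⟩
    -- The endpoints of `g⁻¹ γ` lie on the axis, so quasiconvexity applies along the whole segment.
    have h4 := hA.infDist_le hne (hγ.smul g⁻¹) le_rfl le_rfl (t := s + u)
      (by rw [h0, inv_smul_smul, Metric.infDist_zero_of_mem hx]; exact hC)
      (by rw [hL, inv_smul_smul, Metric.infDist_zero_of_mem hy]; exact hC)
      ⟨by linarith [hu.1], by linarith [hu.2]⟩
    obtain ⟨_, ⟨m, rfl⟩, hm⟩ := (Metric.infDist_lt_iff hne).1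
      (h3.trans_lt (show 4 * C + 2 < 4 * C + 3 by linarith))
    obtain ⟨_, ⟨n, rfl⟩, hn⟩ := (Metric.infDist_lt_iff hne).1
      (h4.trans_lt (show 4 * C + 2 < 4 * C + 3 by linarith))
    rw [dist_smul_left_eq, inv_inv] at hn
    exact ⟨m, n, hm.le, hn.le⟩

/-- Translates of a contracting orbit by elements outside of the stabilizer of the axis
have uniformly bounded projections. -/
theorem exists_proj_bound (hX : IsGeodesicSpace X) (hprop : IsProperAction G X)
    (hf : IsContractingElement o f) :
    ∃ B : ℝ, ∀ s ∉ axisStabilizer f, ∀ x ∈ cyclicOrbit o f, ∀ y ∈ cyclicOrbit o f,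
      ∀ p ∈ proj (cyclicOrbit o f) (s • x), ∀ q ∈ proj (cyclicOrbit o f) (s • y),
        dist p q ≤ B := by
  obtain ⟨⟨C, hC, hA⟩, lam, c, hqi⟩ := hf
  have hpos := stableLength_pos_of_quasiIsometricEmbedding hqi
  set R : ℝ := 4 * C + 3 with hR
  have hfin := hprop o (2 * R)
  set K : ℕ := hfin.toFinset.card
  -- The bound leaves room for `K + 1` sample points, spaced `2 * R + 1` apart, on a geodesic
  -- fellow-travelling both axes; only `K` elements move `o` by at most `2 * R`.
  refine ⟨K * (2 * R + 1) + (4 * C + 2) + C, fun s hs x hx y hy p hp q hq => ?_⟩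
  by_contra! hlt
  refine hs ?_
  have hKD : 0 ≤ K * (2 * R + 1) := by positivity
  obtain ⟨γ, M, hM, hγ, hclose⟩ := exists_fellow_geodesic hX hC hA hx hy hp hq (by linarith)
  have hmem : ∀ k ∈ Finset.range (K + 1), (k : ℝ) * (2 * R + 1) ∈ Set.Icc 0 M := by
    intro k hk
    have hk' : (k : ℝ) ≤ K := by exact_mod_cast Nat.lt_succ_iff.1 (Finset.mem_range.1 hk)
    refine ⟨by positivity, ?_⟩
    have : (k : ℝ) * (2 * R + 1) ≤ K * (2 * R + 1) := by gcongr
    linarith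
  have hclose' : ∀ k : ℕ, ∃ m n : ℤ, k ∈ Finset.range (K + 1) →
      dist (γ (k * (2 * R + 1))) (f ^ m • o) ≤ R ∧
      dist (γ (k * (2 * R + 1))) (s • f ^ n • o) ≤ R := by
    intro k
    by_cases hk : k ∈ Finset.range (K + 1)
    · obtain ⟨m, n, h⟩ := hclose _ (hmem k hk)
      exact ⟨m, n, fun _ => h⟩
    · exact ⟨0, 0, fun h => absurd h hk⟩
  choose m n hmn using hclose'
  obtain ⟨i, hi, j, hj, hij, he⟩ := Finset.exists_ne_map_eq_of_card_lt_of_maps_to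
    (s := Finset.range (K + 1)) (t := hfin.toFinset) (by simp [K])
    (f := fun k => (f ^ m k)⁻¹ * s * f ^ n k) (by
      intro k hk
      rw [Set.Finite.coe_toFinset]
      have h1 := hmn k hk
      have h2 := dist_triangle_left (f ^ m k • o) (s • f ^ n k • o) (γ (k * (2 * R + 1)))
      change dist o (((f ^ m k)⁻¹ * s * f ^ n k) • o) ≤ 2 * R
      rw [mul_smul, mul_smul, ← dist_smul_left_eq]
      linarith)
  -- Two samples with the same element `f⁻ᵐ s fⁿ` make `s` conjugate one power of `f` to another.
  have hconj : s * f ^ (n i - n j) * s⁻¹ = f ^ (m i - m j) := by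
    have h1 : s * f ^ n i = f ^ m i * ((f ^ m j)⁻¹ * s * f ^ n j) := by
      rw [← he]; group
    rw [zpow_sub, zpow_sub, ← mul_assoc, h1]
    simp [mul_assoc]
  have hne : n i - n j ≠ 0 := by
    intro h0
    have h1 := (hmn i hi).2
    have h2 := (hmn j hj).2
    rw [sub_eq_zero.1 h0] at h1
    have h3 := hγ.2 _ (hmem i hi) _ (hmem j hj)
    have h4 := dist_triangle_right (γ (i * (2 * R + 1))) (γ (j * (2 * R + 1))) (s • f ^ n j • o)
    rw [← sub_mul, abs_mul, abs_of_pos (by linarith : 0 < 2 * R + 1)] at h3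
    have h5 : (1 : ℝ) ≤ |(i : ℝ) - j| := by
      have : (1 : ℤ) ≤ |(i : ℤ) - j| := Int.one_le_abs (sub_ne_zero.2 (by exact_mod_cast hij))
      exact_mod_cast this
    nlinarith
  refine ⟨n i - n j, hne, ?_⟩
  rcases Int.natAbs_eq_natAbs_iff.1 (natAbs_eq_of_conj_zpow hpos hconj) with h | h
  · exact ⟨1, by rw [hconj, h]; simp⟩
  · exact ⟨-1, by rw [hconj, h]; simp⟩

end CyclicOrbit

/-! ### Barriers, and moving a finite set off the axis stabilizer -/

section Barrier

variable {G X : Type*} [Group G] [MetricSpace X] [MulAction G X] {o : X} {f : G}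

theorem finite_setOf_dist_zpow_le {lam c : ℝ}
    (hf : IsQuasiIsometricEmbedding lam c fun n : ℤ => f ^ n • o) (r : ℝ) :
    {n : ℤ | dist o (f ^ n • o) ≤ r}.Finite := by
  refine (isCompact_closedBall (0 : ℤ) (lam * (r + c))).finite_of_discrete.subset fun n hn => ?_
  have h := (hf.2.2 0 n).1
  have hlam : 0 < lam := zero_lt_one.trans_le hf.1
  simp only [zpow_zero, one_smul] at h
  rw [Metric.mem_closedBall, dist_comm]
  rw [one_div, inv_mul_eq_div, sub_le_iff_le_add, div_le_iff₀ hlam] at h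
  have h' : dist o (f ^ n • o) ≤ r := hn
  nlinarith

theorem exists_lt_dist_zpow (hf : ∀ r : ℝ, {n : ℤ | dist o (f ^ n • o) ≤ r}.Finite)
    {a : ℤ} (ha : a ≠ 0) (r : ℝ) : ∃ k : ℤ, r < dist o (f ^ (a * k) • o) := by
  by_contra! h
  have := (hf r).preimage (f := fun k : ℤ => a * k) (mul_right_injective₀ ha).injOn
  exact Set.infinite_univ (this.subset fun k _ => h k)

theorem exists_dist_smul_le (o : X) {S : Set G} (hS : S.Finite) :
    ∃ D : ℝ, 0 ≤ D ∧ ∀ s ∈ S, dist o (s • o) ≤ D := by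
  obtain ⟨D, hD⟩ := (hS.image fun s => dist o (s • o)).bddAbove
  exact ⟨max D 0, le_max_right _ _, fun s hs => (hD ⟨s, hs, rfl⟩).trans (le_max_left _ _)⟩

/-- The orbit `⟨f⟩ o` is unbounded, it is a barrier for distant projections, and its translates
outside of the stabilizer of the axis have bounded projections. -/
structure IsBarrier (o : X) (f : G) (c : ℝ) : Prop where
  nonneg : 0 ≤ c
  finite : ∀ r : ℝ, {n : ℤ | dist o (f ^ n • o) ≤ r}.Finite
  add_le : ∀ {x y p q : X}, p ∈ proj (cyclicOrbit o f) x → q ∈ proj (cyclicOrbit o f) y →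
    c < dist p q → dist x p + dist p q + dist q y ≤ dist x y + c
  bound : ∀ {s : G}, s ∉ axisStabilizer f → ∀ {x y p q : X}, x ∈ cyclicOrbit o f →
    y ∈ cyclicOrbit o f → p ∈ proj (cyclicOrbit o f) (s • x) →
    q ∈ proj (cyclicOrbit o f) (s • y) → dist p q ≤ c

theorem proj_cyclicOrbit_nonempty (o : X) (f : G) (x : X) : (proj (cyclicOrbit o f) x).Nonempty :=
  proj_nonempty ⟨o, self_mem_cyclicOrbit o f⟩ x

theorem dist_le_of_mem_proj_smul {g : G} {p : X} (hp : p ∈ proj (cyclicOrbit o f) (g • o)) :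
    dist o p ≤ 2 * dist o (g • o) + 1 := by
  have h1 := dist_le_of_mem_proj hp (self_mem_cyclicOrbit o f)
  have h2 := dist_triangle o (g • o) p
  rw [dist_comm (g • o) o] at h1
  linarith

/-- Coarse Lipschitz property: distant projections force the barrier inequality. -/
theorem IsBarrier.dist_proj_le {c : ℝ} (h : IsBarrier o f c) {x y p q : X} (hp : p ∈ proj (cyclicOrbit o f) x)
    (hq : q ∈ proj (cyclicOrbit o f) y) : dist p q ≤ dist x y + c := by
  rcases le_or_gt (dist p q) c with h1 | h1
  · linarith [dist_nonneg (x := x) (y := y)]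
  · linarith [h.add_le hp hq h1, dist_nonneg (x := x) (y := p), dist_nonneg (x := q) (y := y)]

variable [IsIsometricSMul G X]

/-- The stabilizer of the axis of a contracting element contains the cyclic group with finite
index. -/
theorem exists_finite_cover_axisStabilizer (hX : IsGeodesicSpace X) (hprop : IsProperAction G X)
    (hf : IsContractingElement o f) :
    ∃ S : Set G, S.Finite ∧ ∀ x ∈ axisStabilizer f, ∃ m : ℤ, ∃ s ∈ S, x = f ^ m * s := by
  obtain ⟨⟨C, hC, hA⟩, lam, c, hqi⟩ := hf
  have hunb := finite_setOf_dist_zpow_le hqi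
  have hne : (cyclicOrbit o f).Nonempty := ⟨o, self_mem_cyclicOrbit o f⟩
  set R : ℝ := 4 * C + 3 with hR
  have hfin := hprop o (2 * R)
  have hclose : ∀ x ∈ axisStabilizer f, ∃ m n : ℤ, dist o (((f ^ m)⁻¹ * x * f ^ n) • o) ≤ 2 * R := by
    intro x hx
    obtain ⟨a, ha, ε, h⟩ := exists_conj_zpow_mul hx
    -- Since `x` conjugates `f ^ (a * k)` to its `ε`-th power, the translated axis is within `d(x o,
    -- o)` of the axis at two places; a large `k` separates their projections by more than `C`.
    obtain ⟨k, hk⟩ := exists_lt_dist_zpow hunb ha (C + 2 * (dist (x • o) o + 1))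
    have hy : dist (x • f ^ (a * k) • o) (f ^ ((ε : ℤ) * (a * k)) • o) = dist (x • o) o := by
      rw [← h k, mul_smul, mul_smul, dist_smul, dist_smul, dist_comm, dist_smul_left_eq, inv_inv,
        dist_comm]
    obtain ⟨p, hp⟩ := proj_nonempty hne (x • o)
    obtain ⟨q, hq⟩ := proj_nonempty hne (x • f ^ (a * k) • o)
    have h1 := dist_le_of_mem_proj hp (self_mem_cyclicOrbit o f)
    have h2 := dist_le_of_mem_proj hq (zpow_smul_mem_cyclicOrbit o f (ε * (a * k)))
    have h3 := dist_triangle4 (x • o) p q (x • f ^ (a * k) • o)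
    rw [dist_smul, dist_comm q] at h3
    obtain ⟨γ, M, -, hγ, hγ'⟩ := exists_fellow_geodesic hX hC hA (self_mem_cyclicOrbit o f)
      (zpow_smul_mem_cyclicOrbit o f (a * k)) hp hq (by linarith)
    obtain ⟨m, n, hm, hn⟩ := hγ' 0 ⟨le_rfl, hγ.1⟩
    refine ⟨m, n, ?_⟩
    rw [mul_smul, mul_smul, ← dist_smul_left_eq]
    linarith [dist_triangle_left (f ^ m • o) (x • f ^ n • o) (γ 0)]
  have hper : ∀ s : G, ∃ a : ℤ, a ≠ 0 ∧ (s ∈ axisStabilizer f →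
      ∃ ε : ℤˣ, ∀ k : ℤ, s * f ^ (a * k) * s⁻¹ = f ^ (ε * (a * k))) := by
    intro s
    by_cases hs : s ∈ axisStabilizer f
    · obtain ⟨a, ha, h⟩ := exists_conj_zpow_mul hs
      exact ⟨a, ha, fun _ => h⟩
    · exact ⟨1, one_ne_zero, fun h => absurd h hs⟩
  choose a ha hconj using hper
  refine ⟨⋃ s ∈ {g : G | dist o (g • o) ≤ 2 * R},
    (fun r : ℤ => s * f ^ (-r)) '' Set.Ico 0 |a s|,
    hfin.biUnion fun s _ => (Set.finite_Ico _ _).image _, fun x hx => ?_⟩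
  obtain ⟨m, n, h⟩ := hclose x hx
  set s := (f ^ m)⁻¹ * x * f ^ n with hs
  have hsE : s ∈ axisStabilizer f := by
    refine mul_mem (mul_mem (inv_mem ?_) hx) ?_ <;> exact zpow_mem_axisStabilizer _
  obtain ⟨ε, hε⟩ := hconj s hsE
  -- Dividing `n` by `a s`, the multiple of `a s` passes to the left of `s` up to sign, and only
  -- finitely many remainders stay on the right.
  have h1 := hε (-(n / a s))
  have h2 : x = f ^ m * s * f ^ (-n) := by rw [hs]; group
  have h3 : -n = a s * (-(n / a s)) + -(n % a s) := by linarith [Int.mul_ediv_add_emod n (a s)]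
  refine ⟨m + ε * (a s * (-(n / a s))), s * f ^ (-(n % a s)), Set.mem_biUnion h
    ⟨n % a s, ⟨Int.emod_nonneg _ (ha s), Int.emod_lt_abs _ (ha s)⟩, rfl⟩, ?_⟩
  rw [zpow_add, ← h1, h2]
  conv_lhs => rw [h3, zpow_add]
  simp only [mul_assoc, inv_mul_cancel_left]

/-- Otherwise the finite cover puts all of `⟨g⟩ o` in a bounded neighbourhood of `⟨f⟩ o`, an
unbounded intersection. -/
theorem notMem_axisStabilizer (hX : IsGeodesicSpace X) (hprop : IsProperAction G X)
    (hf : IsContractingElement o f) {g : G} (hg : IsContractingElement o g)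
    (hfg : HasBoundedIntersection (cyclicOrbit o f) (cyclicOrbit o g)) :
    g ∉ axisStabilizer f := by
  intro hgE
  obtain ⟨S, hS, hcov⟩ := exists_finite_cover_axisStabilizer hX hprop hf
  obtain ⟨-, lam, c, hqi⟩ := hg
  obtain ⟨D, hD0, hD⟩ := exists_dist_smul_le o hS
  obtain ⟨R, hR⟩ := hfg
  obtain ⟨k, hk⟩ := exists_lt_dist_zpow (finite_setOf_dist_zpow_le hqi) one_ne_zero
    (R ⟨D, hD0⟩ : ℝ)
  refine absurd hk (not_lt.2 (hR ⟨D, hD0⟩ o ⟨?_, ?_⟩ _ ⟨?_, ?_⟩))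
  · exact Metric.self_subset_cthickening _ (self_mem_cyclicOrbit o f)
  · exact Metric.self_subset_cthickening _ (self_mem_cyclicOrbit o g)
  · obtain ⟨m, s, hs, he⟩ := hcov (g ^ (1 * k)) (zpow_mem hgE _)
    refine Metric.mem_cthickening_of_dist_le _ _ _ _ (zpow_smul_mem_cyclicOrbit o f m) ?_
    rw [he, mul_smul, dist_smul, dist_comm]
    exact hD s hs
  · exact Metric.self_subset_cthickening _ (zpow_smul_mem_cyclicOrbit o g _)

theorem IsContractingElement.exists_isBarrier (hX : IsGeodesicSpace X)
    (hprop : IsProperAction G X) (hf : IsContractingElement o f) : ∃ c, IsBarrier o f c := by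
  obtain ⟨B, hB⟩ := exists_proj_bound hX hprop hf
  obtain ⟨⟨C, hC, hA⟩, lam, c, hqi⟩ := hf
  refine ⟨max B (8 * C + 4), by positivity, finite_setOf_dist_zpow_le hqi,
    fun hp hq hpq => ?_, fun hs _ _ _ _ hx hy hp hq => ?_⟩
  · have h1 := le_max_right B (8 * C + 4)
    have h2 := hA.dist_proj_add_le hX hC hp hq (by linarith)
    linarith
  · exact (hB _ hs _ hx _ hy _ hp _ hq).trans (le_max_left _ _)

namespace IsBarrier

variable {c : ℝ}

/-- The Behrstock inequality for the axis of `f` and its translate by `s`. -/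
theorem behrstock (h : IsBarrier o f c) {s : G} {x p r p' r' : X}
    (hp : p ∈ proj (cyclicOrbit o f) x) (hr : r ∈ proj (cyclicOrbit o f) (s⁻¹ • x))
    (hp' : p' ∈ proj (cyclicOrbit o f) (s • r)) (hr' : r' ∈ proj (cyclicOrbit o f) (s⁻¹ • p)) :
    dist p p' ≤ c ∨ dist r r' ≤ c := by
  by_contra! hlt
  -- If both gaps were large, `x` would be strictly closer to `p` than to `s • r`, and conversely.
  have h1 := h.add_le hp hp' hlt.1
  have h2 := h.add_le hr hr' hlt.2
  rw [dist_smul] at h2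
  rw [dist_comm x (s • r), dist_smul_left_eq, dist_comm r] at h1
  linarith [dist_nonneg (x := p') (y := s • r), dist_nonneg (x := r') (y := s⁻¹ • p)]

/-- If `y` stabilizes the axis, then `v⁻¹ y` and `v⁻¹` move the axis to
translates with the same projection. -/
theorem dist_proj_le_of_mem (h : IsBarrier o f c) {v y : G} (hv : v ∉ axisStabilizer f)
    (hy : y ∈ axisStabilizer f) {b b' p q : X} (hb : b ∈ cyclicOrbit o f)
    (hb' : b' ∈ cyclicOrbit o f) (hp : p ∈ proj (cyclicOrbit o f) ((v⁻¹ * y) • b))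
    (hq : q ∈ proj (cyclicOrbit o f) (v⁻¹ • b')) : dist p q ≤ 3 * c := by
  have hv' : v⁻¹ ∉ axisStabilizer f := by rwa [inv_mem_iff]
  have hvy : v⁻¹ * y ∉ axisStabilizer f := by rwa [Subgroup.mul_mem_cancel_right _ hy]
  obtain ⟨a, ha, ε, hε⟩ := exists_conj_zpow_mul hy
  obtain ⟨q₀, hq₀⟩ := proj_cyclicOrbit_nonempty o f (v⁻¹ • o)
  have hε0 : (ε : ℤ) * a ≠ 0 := mul_ne_zero ε.ne_zero ha
  -- The two translates keep bounded distance `d(y o, o)` at points arbitrarily far from the axis;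
  -- there the barrier inequality forces the projections to be `c`-close.
  obtain ⟨k, hk⟩ := exists_lt_dist_zpow h.finite hε0
    (dist (y • o) o + 2 * c + dist (v⁻¹ • o) q₀)
  rw [mul_assoc] at hk
  obtain ⟨p₁, hp₁⟩ := proj_cyclicOrbit_nonempty o f ((v⁻¹ * y) • f ^ (a * k) • o)
  obtain ⟨p₂, hp₂⟩ := proj_cyclicOrbit_nonempty o f (v⁻¹ • f ^ ((ε : ℤ) * (a * k)) • o)
  have h1 : dist ((v⁻¹ * y) • f ^ (a * k) • o) (v⁻¹ • f ^ ((ε : ℤ) * (a * k)) • o) =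
      dist (y • o) o := by
    rw [← hε k, mul_smul, dist_smul, mul_smul, mul_smul, dist_smul, dist_smul, dist_comm,
      dist_smul_left_eq, inv_inv, dist_comm]
  have h2 : dist p₁ p₂ ≤ c := by
    by_contra! hlt
    have h3 := h.add_le hp₁ hp₂ hlt
    have h4 := h.bound hv' (self_mem_cyclicOrbit o f)
      (zpow_smul_mem_cyclicOrbit o f (ε * (a * k))) hq₀ hp₂
    have h5 := dist_triangle4 (v⁻¹ • o) q₀ p₂ (v⁻¹ • f ^ ((ε : ℤ) * (a * k)) • o)
    rw [dist_smul] at h5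
    linarith [dist_nonneg (x := (v⁻¹ * y) • f ^ (a * k) • o) (y := p₁),
      dist_nonneg (x := p₁) (y := p₂)]
  have h3 := h.bound hvy hb (zpow_smul_mem_cyclicOrbit o f _) hp hp₁
  have h4 := h.bound hv' (zpow_smul_mem_cyclicOrbit o f _) hb' hp₂ hq
  linarith [dist_triangle4 p p₁ p₂ q]

/-- Membership makes `f ^ k` times a fixed projection `3 * c`-close to another fixed one. -/
theorem finite_zpow_mul_conj_mem (h : IsBarrier o f c) {v : G} (hv : v ∉ axisStabilizer f)
    (s : G) : {k : ℤ | v * (f ^ k * s) * v⁻¹ ∈ axisStabilizer f}.Finite := by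
  obtain ⟨p, hp⟩ := proj_cyclicOrbit_nonempty o f ((s * v⁻¹) • o)
  obtain ⟨q, hq⟩ := proj_cyclicOrbit_nonempty o f (v⁻¹ • o)
  refine (h.finite (dist o q + 3 * c + dist p o)).subset fun k hk => ?_
  have h1 := h.dist_proj_le_of_mem hv hk (self_mem_cyclicOrbit o f) (self_mem_cyclicOrbit o f)
    (p := f ^ k • p) (by
      convert zpow_smul_mem_proj k hp using 2
      rw [smul_smul]; congr 1; group) hq
  have h2 := dist_triangle4 o q (f ^ k • p) (f ^ k • o)
  rw [dist_smul, dist_comm q] at h2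
  simp only [Set.mem_ofPred_eq]
  linarith

/-- Membership places `f ^ k • p` near `b`. By the Behrstock inequality for the axis and its
translate by `q`, either `p` is near the projection of `q • o`, or `f ^ (-k) • b` is near that of
`q⁻¹ • o`; both bound `k`. -/
theorem finite_conj_zpow_mem (h : IsBarrier o f c) {v q : G} (hv : v ∉ axisStabilizer f)
    (hq : q ∉ axisStabilizer f) :
    {k : ℤ | v * (f ^ k * q * (f ^ k)⁻¹) * v⁻¹ ∈ axisStabilizer f}.Finite := by
  have hq' : q⁻¹ ∉ axisStabilizer f := by rwa [inv_mem_iff]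
  obtain ⟨b, hb⟩ := proj_cyclicOrbit_nonempty o f (v⁻¹ • o)
  obtain ⟨e, he⟩ := proj_cyclicOrbit_nonempty o f (q • o)
  obtain ⟨e', he'⟩ := proj_cyclicOrbit_nonempty o f (q⁻¹ • o)
  refine (h.finite (dist o b + 5 * c + dist e o + dist b o + dist o e')).subset fun k hk => ?_
  simp only [Set.mem_ofPred_eq]
  have hr : f ^ (-k) • b ∈ proj (cyclicOrbit o f) (q⁻¹ • (q * f ^ (-k) * v⁻¹) • o) := by
    convert zpow_smul_mem_proj (-k) hb using 2
    rw [smul_smul, smul_smul]; congr 1; group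
  obtain ⟨p, hp⟩ := proj_cyclicOrbit_nonempty o f ((q * f ^ (-k) * v⁻¹) • o)
  obtain ⟨p', hp'⟩ := proj_cyclicOrbit_nonempty o f (q • f ^ (-k) • b)
  obtain ⟨r', hr'⟩ := proj_cyclicOrbit_nonempty o f (q⁻¹ • p)
  have h1 := h.dist_proj_le_of_mem hv hk (self_mem_cyclicOrbit o f) (self_mem_cyclicOrbit o f)
    (p := f ^ k • p) (by
      convert zpow_smul_mem_proj k hp using 2
      rw [smul_smul]; congr 1; group) hb
  have n1 := dist_nonneg (x := o) (y := b)
  have n2 := dist_nonneg (x := e) (y := o)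
  have n3 := dist_nonneg (x := o) (y := e')
  have n4 := h.nonneg
  rw [dist_comm b o]
  rcases h.behrstock hp hr hp' hr' with h2 | h2
  · have h3 := h.bound hq hr.1 (self_mem_cyclicOrbit o f) hp' he
    have h4 := dist_triangle4 o b (f ^ k • p) (f ^ k • o)
    have h5 := dist_triangle4 p p' e o
    rw [dist_smul, dist_comm b] at h4
    linarith
  · have h3 := h.bound hq' hp.1 (self_mem_cyclicOrbit o f) hr' he'
    have h4 := dist_triangle4 (f ^ (-k) • b) r' e' o
    have h5 := dist_triangle (f ^ (-k) • o) (f ^ (-k) • b) o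
    have h6 : dist o (f ^ k • o) = dist (f ^ (-k) • o) o := by
      rw [zpow_neg, dist_smul_left_eq, inv_inv]
    rw [dist_smul, dist_comm o b] at h5
    linarith [dist_comm e' o, dist_comm b o]

/-- The normal core of the stabilizer of the axis is a finite normal subgroup. -/
theorem normalCore_le_ellipticRadical (h : IsBarrier o f c) {v : G} (hv : v ∉ axisStabilizer f)
    {S : Set G} (hS : S.Finite)
    (hcov : ∀ x ∈ axisStabilizer f, ∃ m : ℤ, ∃ s ∈ S, x = f ^ m * s) :
    (axisStabilizer f).normalCore ≤ ellipticRadical G := by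
  refine le_sSup ⟨inferInstance, ?_⟩
  refine Set.Finite.to_subtype ((hS.biUnion fun s _ =>
    (h.finite_zpow_mul_conj_mem hv s).image fun k => f ^ k * s).subset fun x hx => ?_)
  obtain ⟨m, s, hs, rfl⟩ := hcov x (Subgroup.normalCore_le _ hx)
  exact Set.mem_biUnion hs ⟨m, hx v, rfl⟩

/-- A finite set that avoids the normal core has a conjugate that avoids the stabilizer of the
axis. -/
theorem exists_conj_notMem (h : IsBarrier o f c) {v : G} (hv : v ∉ axisStabilizer f)
    {P : Set G} (hP : P.Finite) (hPN : ∀ p ∈ P, p ∉ (axisStabilizer f).normalCore) :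
    ∃ w : G, ∀ p ∈ P, w * p * w⁻¹ ∉ axisStabilizer f := by
  induction P, hP using Set.Finite.induction_on with
  | empty => exact ⟨1, by simp⟩
  | @insert p P _ hP ih =>
    obtain ⟨w, hw⟩ := ih fun p' hp' => hPN p' (Set.mem_insert_of_mem _ hp')
    by_cases hwp : w * p * w⁻¹ ∈ axisStabilizer f
    swap
    · refine ⟨w, fun p' hp' => ?_⟩
      rcases hp' with rfl | hp'
      exacts [hwp, hw p' hp']
    set q := w * p * w⁻¹ with hq
    have hqN : q ∉ (axisStabilizer f).normalCore := fun hqN => hPN p (Set.mem_insert _ _) (by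
      have := (axisStabilizer f).normalCore_normal.conj_mem q hqN w⁻¹
      rwa [hq, show w⁻¹ * (w * p * w⁻¹) * w⁻¹⁻¹ = p by group] at this)
    -- Conjugation by `u * f ^ (a * k)` is to expel `q` while keeping the earlier elements out, each
    -- for all but finitely many `k`. If `ε = 1`, then `q` commutes with `f ^ a` and some `u` expels
    -- it; if `ε = -1`, the inner conjugate is `f ^ (2 * a * k) * q`.
    obtain ⟨u, a, ha, hu, hbad⟩ : ∃ u : G, ∃ a : ℤ, a ≠ 0 ∧ u ∉ axisStabilizer f ∧
        {k : ℤ | u * (f ^ (a * k) * q * (f ^ (a * k))⁻¹) * u⁻¹ ∈ axisStabilizer f}.Finite := by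
      obtain ⟨a, ha, ε, hε⟩ := exists_conj_zpow_mul hwp
      rcases Int.units_eq_one_or ε with rfl | rfl
      · obtain ⟨u, hu⟩ : ∃ u, u * q * u⁻¹ ∉ axisStabilizer f := by
          by_contra! hall
          exact hqN hall
        refine ⟨u, a, ha, fun huE => hu (mul_mem (mul_mem huE hwp) (inv_mem huE)), ?_⟩
        convert Set.finite_empty
        ext k
        have h1 : f ^ (a * k) * q = q * f ^ (a * k) := by
          have := hε k
          rw [Units.val_one, one_mul, mul_inv_eq_iff_eq_mul] at this
          exact this.symm
        simp only [h1, mul_inv_cancel_right, Set.mem_ofPred_eq, Set.mem_empty_iff_false, iff_false]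
        exact hu
      · refine ⟨v, a, ha, hv, ?_⟩
        refine ((h.finite_zpow_mul_conj_mem hv q).preimage (f := fun k : ℤ => 2 * a * k)
          (mul_right_injective₀ (mul_ne_zero two_ne_zero ha)).injOn).subset fun k hk => ?_
        have h1 : q * (f ^ (a * k))⁻¹ = f ^ (a * k) * q := by
          have := hε (-k)
          rw [mul_inv_eq_iff_eq_mul, mul_neg, zpow_neg] at this
          rw [this]
          congr 2
          simp
        simp only [Set.mem_ofPred_eq, mul_assoc (f ^ (a * k)), h1] at hk
        simp only [Set.mem_preimage, Set.mem_ofPred_eq]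
        rwa [← mul_assoc (f ^ (a * k)), ← zpow_add,
          show a * k + a * k = 2 * a * k by ring] at hk
    have hbad' : (⋃ p' ∈ P, {k : ℤ | u * (f ^ (a * k) * (w * p' * w⁻¹) * (f ^ (a * k))⁻¹) * u⁻¹ ∈
        axisStabilizer f}).Finite :=
      hP.biUnion fun p' hp' => (h.finite_conj_zpow_mem hu (hw p' hp')).preimage
        (f := fun k : ℤ => a * k) (mul_right_injective₀ ha).injOn
    obtain ⟨k, hk⟩ := (hbad.union hbad').exists_notMem
    rw [Set.mem_union, not_or] at hk
    refine ⟨u * f ^ (a * k) * w, fun p' hp' => ?_⟩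
    have e : ∀ g : G, u * f ^ (a * k) * w * g * (u * f ^ (a * k) * w)⁻¹ =
        u * (f ^ (a * k) * (w * g * w⁻¹) * (f ^ (a * k))⁻¹) * u⁻¹ := fun g => by group
    rw [e]
    rcases hp' with rfl | hp'
    · exact hk.1
    · exact fun hmem => hk.2 (Set.mem_biUnion hp' hmem)

end IsBarrier

end Barrier

/-! ### Chains of barriers and confined subgroups -/

section Confined

variable {G X : Type*} [Group G] [MetricSpace X] [MulAction G X] {o : X} {f : G}

/-- An orbit map that almost preserves distances is a rough isometry. -/
theorem IsOrbitMap.isRoughIsometry {X' : Type*} [MetricSpace X'] [MulAction G X'] {o' : X'} {C : ℝ}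
    (hC : ∀ g h : G, |dist (g • o) (h • o) - dist (g • o') (h • o')| ≤ C)
    {ρ : MulAction.orbit G o → MulAction.orbit G o'} (hρ : IsOrbitMap ρ) : IsRoughIsometry ρ := by
  have hC0 : 0 ≤ C := (abs_nonneg _).trans (hC 1 1)
  choose r hr hr' using hρ
  choose u hu using fun y : MulAction.orbit G o' => y.2
  refine ⟨C, hC0, ⟨le_rfl, hC0, fun x y => ?_⟩,
    fun y => ⟨u y • o, MulAction.mem_orbit _ _⟩, C, fun x => ?_, fun y => ?_⟩
  · have h1 := abs_le.1 (hC (r x) (r y))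
    rw [Subtype.dist_eq, Subtype.dist_eq, hr x, hr y, hr' x, hr' y]
    constructor <;> linarith
  · have h1 := abs_le.1 (hC (r x) (u (ρ x)))
    have h2 : u (ρ x) • o' = r x • o' := (hu (ρ x)).trans (hr' x)
    rw [h2, dist_self] at h1
    rw [Subtype.dist_eq, hr x]
    linarith
  · have h1 := abs_le.1 (hC (u y) (r ⟨u y • o, MulAction.mem_orbit _ _⟩))
    rw [← hr ⟨u y • o, MulAction.mem_orbit _ _⟩, dist_self] at h1
    rw [Subtype.dist_eq, hr', ← show u y • o' = y from hu y]
    linarith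

variable [IsIsometricSMul G X]

namespace IsBarrier

variable {c : ℝ}

/-- One step of a chain of barriers: if `x` projects to the axis like the previous barrier, far
from the next barrier, then the same holds one step later, and distances add up. -/
theorem chain_step (h : IsBarrier o f c) {s' s : G} {x : X} {M : ℝ} (hs : s ∉ axisStabilizer f)
    (hx : ∀ p ∈ proj (cyclicOrbit o f) x, ∀ e ∈ proj (cyclicOrbit o f) (s'⁻¹ • o),
      dist p e ≤ 2 * c)
    (hgap : ∀ e ∈ proj (cyclicOrbit o f) (s'⁻¹ • o), ∀ e' ∈ proj (cyclicOrbit o f) (s • o),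
      4 * c < dist e e')
    (hM : ∀ e ∈ proj (cyclicOrbit o f) (s'⁻¹ • o), dist o e ≤ M) :
    (∀ p ∈ proj (cyclicOrbit o f) (s⁻¹ • x), ∀ e ∈ proj (cyclicOrbit o f) (s⁻¹ • o),
      dist p e ≤ 2 * c) ∧
    dist x o + dist o (s • o) ≤ dist (s⁻¹ • x) o + (2 * M + 5 * c) := by
  have hs' : s⁻¹ ∉ axisStabilizer f := by rwa [inv_mem_iff]
  have hc := h.nonneg
  obtain ⟨p, hp⟩ := proj_cyclicOrbit_nonempty o f x
  obtain ⟨e, he⟩ := proj_cyclicOrbit_nonempty o f (s'⁻¹ • o)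
  obtain ⟨e', he'⟩ := proj_cyclicOrbit_nonempty o f (s • o)
  have h1 := hx p hp e he
  have h2 := hgap e he e' he'
  refine ⟨fun r hr d hd => ?_, ?_⟩
  · obtain ⟨p', hp'⟩ := proj_cyclicOrbit_nonempty o f (s • r)
    obtain ⟨r', hr'⟩ := proj_cyclicOrbit_nonempty o f (s⁻¹ • p)
    have h3 := h.bound hs hr.1 (self_mem_cyclicOrbit o f) hp' he'
    have h4 := h.bound hs' hp.1 (self_mem_cyclicOrbit o f) hr' hd
    -- The first alternative would close the gap: `2 * c` from `hx`, `c` from Behrstock, `c` from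
    -- bounded projection.
    rcases h.behrstock hp hr hp' hr' with h5 | h5
    · linarith [dist_triangle4 e p p' e', dist_comm e p]
    · linarith [dist_triangle r r' d]
  · have h3 := h.add_le hp he' (by linarith [dist_triangle e p e', dist_comm e p])
    have h4 := hM e he
    rw [dist_comm (s⁻¹ • x) o, ← dist_smul_left_eq, dist_comm (s • o) x]
    have h5 := dist_triangle x p o
    have h6 := dist_triangle4 o p e' (s • o)
    have h7 := dist_triangle p e o
    linarith [dist_comm o p, dist_comm o e]

/-- Projections of `t`, `t⁻¹` within `K` and of the other letters beyond `K + 4 * c` leave a gap at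
every barrier. Each period of four chain steps gains `2 * dist o (t • o)` up to four errors. -/
theorem le_stableLength_of_alternating (h : IsBarrier o f c) {t a a' : G} {K M : ℝ}
    (hKM : K ≤ M) (ht : t ∉ axisStabilizer f) (ha : a ∉ axisStabilizer f)
    (ha' : a' ∉ axisStabilizer f)
    (ht₁ : ∀ e ∈ proj (cyclicOrbit o f) (t • o), dist o e ≤ K)
    (ht₂ : ∀ e ∈ proj (cyclicOrbit o f) (t⁻¹ • o), dist o e ≤ K)
    (ha₁ : ∀ e ∈ proj (cyclicOrbit o f) (a • o), K + 4 * c < dist o e)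
    (ha₂ : ∀ e ∈ proj (cyclicOrbit o f) (a⁻¹ • o), K + 4 * c < dist o e ∧ dist o e ≤ M)
    (ha'₁ : ∀ e ∈ proj (cyclicOrbit o f) (a' • o), K + 4 * c < dist o e)
    (ha'₂ : ∀ e ∈ proj (cyclicOrbit o f) (a'⁻¹ • o), K + 4 * c < dist o e ∧ dist o e ≤ M) :
    2 * dist o (t • o) ≤ stableLength o (t * a * t⁻¹ * a') + 4 * (2 * M + 5 * c) := by
  have ht' : t⁻¹ ∉ axisStabilizer f := by rwa [inv_mem_iff]
  set g := t * a * t⁻¹ * a' with hg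
  have hgap : ∀ {e e' : X}, dist o e ≤ K → K + 4 * c < dist o e' → 4 * c < dist e e' := by
    intro e e' h1 h2
    linarith [dist_triangle o e e']
  have hgap' : ∀ {e e' : X}, K + 4 * c < dist o e → dist o e' ≤ K → 4 * c < dist e e' := by
    intro e e' h1 h2
    linarith [dist_triangle o e' e, dist_comm e e']
  have hloop : ∀ x : X, (∀ p ∈ proj (cyclicOrbit o f) x,
      ∀ e ∈ proj (cyclicOrbit o f) (a'⁻¹ • o), dist p e ≤ 2 * c) →
      (∀ p ∈ proj (cyclicOrbit o f) (g⁻¹ • x),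
        ∀ e ∈ proj (cyclicOrbit o f) (a'⁻¹ • o), dist p e ≤ 2 * c) ∧
      dist x o + 2 * dist o (t • o) ≤ dist (g⁻¹ • x) o + 4 * (2 * M + 5 * c) := by
    intro x hx
    obtain ⟨h1, d1⟩ := h.chain_step ht hx (fun e he e' he' => hgap' (ha'₂ e he).1 (ht₁ e' he'))
      fun e he => (ha'₂ e he).2
    obtain ⟨h2, d2⟩ := h.chain_step ha h1 (fun e he e' he' => hgap (ht₂ e he) (ha₁ e' he'))
      fun e he => (ht₂ e he).trans hKM
    obtain ⟨h3, d3⟩ := h.chain_step ht' h2 (fun e he e' he' => hgap' (ha₂ e he).1 (ht₂ e' he'))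
      fun e he => (ha₂ e he).2
    obtain ⟨h4, d4⟩ := h.chain_step ha' h3
      (fun e he e' he' => hgap (ht₁ e (by rwa [inv_inv] at he)) (ha'₁ e' he'))
      fun e he => (ht₁ e (by rwa [inv_inv] at he)).trans hKM
    have e1 : a'⁻¹ • t⁻¹⁻¹ • a⁻¹ • t⁻¹ • x = g⁻¹ • x := by
      simp only [smul_smul, hg]
      congr 1
      group
    have e2 : dist o (t⁻¹ • o) = dist o (t • o) := by rw [← dist_smul_left_eq, dist_comm]
    rw [e1] at h4 d4
    refine ⟨h4, ?_⟩
    linarith [dist_nonneg (x := o) (y := a • o), dist_nonneg (x := o) (y := a' • o)]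
  have hind : ∀ n : ℕ, (∀ p ∈ proj (cyclicOrbit o f) ((g⁻¹) ^ n • a'⁻¹ • o),
      ∀ e ∈ proj (cyclicOrbit o f) (a'⁻¹ • o), dist p e ≤ 2 * c) ∧
      (2 * dist o (t • o) - 4 * (2 * M + 5 * c)) * n ≤ dist ((g⁻¹) ^ n • a'⁻¹ • o) o := by
    intro n
    induction n with
    | zero =>
      have hc := h.nonneg
      refine ⟨fun p hp e he => ?_, by simp⟩
      rw [pow_zero, one_smul] at hp
      linarith [h.bound (by rwa [inv_mem_iff] : a'⁻¹ ∉ axisStabilizer f)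
        (self_mem_cyclicOrbit o f) (self_mem_cyclicOrbit o f) hp he]
    | succ n ih =>
      obtain ⟨h1, h2⟩ := hloop _ ih.1
      rw [pow_succ', mul_smul]
      refine ⟨h1, ?_⟩
      push_cast
      linarith [ih.2]
  have := le_stableLength_of_le (o := o) (g := g) (c := 2 * dist o (t • o) - 4 * (2 * M + 5 * c))
    (D := dist o (a' • o)) fun n => by
      have h1 := (hind n).2
      rw [inv_pow, dist_smul_left_eq, inv_inv] at h1
      have h2 := dist_triangle (a'⁻¹ • o) o (g ^ n • o)
      have h3 : dist (a'⁻¹ • o) o = dist o (a' • o) := by rw [dist_smul_left_eq, inv_inv]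
      linarith
  linarith

/-- A point projects close to the basepoint for one of two independent axes. -/
theorem exists_proj_near_or (h : IsBarrier o f c) {s : G} (hs : s ∉ axisStabilizer f) :
    ∃ K : ℝ, ∀ x : X, (∀ p ∈ proj (cyclicOrbit o f) x, dist o p ≤ K) ∨
      ∀ r ∈ proj (cyclicOrbit o f) (s⁻¹ • x), dist o r ≤ K := by
  have hs' : s⁻¹ ∉ axisStabilizer f := by rwa [inv_mem_iff]
  obtain ⟨e, he⟩ := proj_cyclicOrbit_nonempty o f (s • o)
  obtain ⟨e', he'⟩ := proj_cyclicOrbit_nonempty o f (s⁻¹ • o)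
  refine ⟨max (dist o e) (dist o e') + 2 * c, fun x => ?_⟩
  by_contra! hlt
  obtain ⟨⟨p, hp, hpK⟩, r, hr, hrK⟩ := hlt
  obtain ⟨p', hp'⟩ := proj_cyclicOrbit_nonempty o f (s • r)
  obtain ⟨r', hr'⟩ := proj_cyclicOrbit_nonempty o f (s⁻¹ • p)
  have h1 := h.bound hs hr.1 (self_mem_cyclicOrbit o f) hp' he
  have h2 := h.bound hs' hp.1 (self_mem_cyclicOrbit o f) hr' he'
  rcases h.behrstock hp hr hp' hr' with h3 | h3
  · linarith [dist_triangle4 o e p' p, le_max_left (dist o e) (dist o e'), dist_comm p p',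
      dist_comm p' e]
  · linarith [dist_triangle4 o e' r' r, le_max_right (dist o e) (dist o e'), dist_comm r r',
      dist_comm r' e']

/-- Some `v * f ^ n * v⁻¹` lies outside the stabilizer, which separates the cosets of `v⁻¹` and `f ^
n * v⁻¹`. -/
theorem exists_three_cosets (h : IsBarrier o f c) {v : G} (hv : v ∉ axisStabilizer f) :
    ∃ k : Fin 3 → G, ∀ i j, i ≠ j → (k i)⁻¹ * k j ∉ axisStabilizer f := by
  obtain ⟨n, hn⟩ := (h.finite_zpow_mul_conj_mem hv 1).exists_notMem
  rw [Set.mem_ofPred_eq, mul_one] at hn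
  have hz : f ^ n ∈ axisStabilizer f := zpow_mem_axisStabilizer n
  have h01 : (1 : G)⁻¹ * v⁻¹ ∉ axisStabilizer f := by simpa using hv
  have h02 : (1 : G)⁻¹ * (f ^ n * v⁻¹) ∉ axisStabilizer f := by
    rw [inv_one, one_mul, Subgroup.mul_mem_cancel_left _ hz]
    simpa using hv
  have h12 : v⁻¹⁻¹ * (f ^ n * v⁻¹) ∉ axisStabilizer f := by
    rwa [inv_inv, ← mul_assoc]
  refine ⟨![1, v⁻¹, f ^ n * v⁻¹], fun i j hij => ?_⟩
  have hsymm : ∀ x y : G, x⁻¹ * y ∉ axisStabilizer f → y⁻¹ * x ∉ axisStabilizer f := by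
    intro x y hxy hyx
    apply hxy
    have := inv_mem hyx
    rwa [mul_inv_rev, inv_inv] at this
  fin_cases i <;> fin_cases j
  · exact absurd rfl hij
  · exact h01
  · exact h02
  · exact hsymm _ _ h01
  · exact absurd rfl hij
  · exact h12
  · exact hsymm _ _ h02
  · exact hsymm _ _ h12
  · exact absurd rfl hij

/-- There are finitely many elements such that every `g` can be extended by two of them to an
element that starts and ends transversally to the axis of `f`. -/
theorem exists_extension (h : IsBarrier o f c) {v : G} (hv : v ∉ axisStabilizer f) :
    ∃ (k : Fin 3 → G) (K : ℝ), ∀ g : G, ∃ i j, (k i)⁻¹ * g * k j ∉ axisStabilizer f ∧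
      (∀ e ∈ proj (cyclicOrbit o f) (((k i)⁻¹ * g * k j) • o), dist o e ≤ K) ∧
      ∀ e ∈ proj (cyclicOrbit o f) (((k i)⁻¹ * g * k j)⁻¹ • o), dist o e ≤ K := by
  obtain ⟨k, hk⟩ := h.exists_three_cosets hv
  have hK : ∀ q : Fin 3 × Fin 3, ∃ K : ℝ, q.1 ≠ q.2 → ∀ x : X,
      (∀ p ∈ proj (cyclicOrbit o f) ((k q.1)⁻¹ • x), dist o p ≤ K) ∨
      ∀ p ∈ proj (cyclicOrbit o f) ((k q.2)⁻¹ • x), dist o p ≤ K := by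
    intro q
    by_cases hq : q.1 = q.2
    · exact ⟨0, fun h => absurd hq h⟩
    · obtain ⟨K, hK⟩ := h.exists_proj_near_or (hk q.1 q.2 hq)
      refine ⟨K, fun _ x => ?_⟩
      have := hK ((k q.1)⁻¹ • x)
      rwa [smul_smul, show ((k q.1)⁻¹ * k q.2)⁻¹ * (k q.1)⁻¹ = (k q.2)⁻¹ by group] at this
  choose K hK using hK
  obtain ⟨K', hK'⟩ := (Set.finite_range K).bddAbove
  have hnear : ∀ i j, i ≠ j → ∀ x : X,
      (∀ p ∈ proj (cyclicOrbit o f) ((k i)⁻¹ • x), dist o p ≤ K') ∨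
      ∀ p ∈ proj (cyclicOrbit o f) ((k j)⁻¹ • x), dist o p ≤ K' := fun i j hij x =>
    (hK (i, j) hij x).imp (fun h p hp => (h p hp).trans (hK' ⟨_, rfl⟩))
      fun h p hp => (h p hp).trans (hK' ⟨_, rfl⟩)
  obtain ⟨D, hD0, hD⟩ := exists_dist_smul_le o (Set.finite_range k)
  refine ⟨k, K' + (D + c), fun g => ?_⟩
  have hmove : ∀ (x : G) (i : Fin 3),
      (∀ p ∈ proj (cyclicOrbit o f) (x • o), dist o p ≤ K') →
      ∀ e ∈ proj (cyclicOrbit o f) ((x * k i) • o), dist o e ≤ K' + (D + c) := by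
    intro x i hx e he
    obtain ⟨p, hp⟩ := proj_cyclicOrbit_nonempty o f (x • o)
    have h1 := h.dist_proj_le hp he
    rw [mul_smul, dist_smul] at h1
    linarith [dist_triangle o p e, hx p hp, hD (k i) ⟨i, rfl⟩]
  obtain ⟨i, hi⟩ : ∃ i, ∀ p ∈ proj (cyclicOrbit o f) ((k i)⁻¹ • g • o), dist o p ≤ K' :=
    (hnear 0 1 (by decide) (g • o)).elim (fun h => ⟨0, h⟩) fun h => ⟨1, h⟩
  have hcoset : ∀ j j', j ≠ j' → (k i)⁻¹ * g * k j ∉ axisStabilizer f ∨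
      (k i)⁻¹ * g * k j' ∉ axisStabilizer f := by
    intro j j' hjj
    by_contra! hmem
    refine hk j j' hjj ?_
    have := mul_mem (inv_mem hmem.1) hmem.2
    rwa [show ((k i)⁻¹ * g * k j)⁻¹ * ((k i)⁻¹ * g * k j') = (k j)⁻¹ * k j' by group] at this
  -- Each of the two requirements fails for at most one of the three indices.
  obtain ⟨j, hj, hjE⟩ : ∃ j, (∀ p ∈ proj (cyclicOrbit o f) ((k j)⁻¹ • g⁻¹ • o), dist o p ≤ K') ∧
      (k i)⁻¹ * g * k j ∉ axisStabilizer f := by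
    have n01 := hnear 0 1 (by decide) (g⁻¹ • o)
    have n02 := hnear 0 2 (by decide) (g⁻¹ • o)
    have n12 := hnear 1 2 (by decide) (g⁻¹ • o)
    have c01 := hcoset 0 1 (by decide)
    have c02 := hcoset 0 2 (by decide)
    have c12 := hcoset 1 2 (by decide)
    by_contra! hno
    have h0 := hno 0
    have h1 := hno 1
    have h2 := hno 2
    tauto
  refine ⟨i, j, hjE, ?_, ?_⟩
  · exact hmove ((k i)⁻¹ * g) j (by rwa [mul_smul])
  · rw [show ((k i)⁻¹ * g * k j)⁻¹ = (k j)⁻¹ * g⁻¹ * k i by group]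
    exact hmove ((k j)⁻¹ * g⁻¹) i (by rwa [mul_smul])

end IsBarrier

/-- A confined subgroup contains, up to bounded error, elements of twice the displacement of any
given element. -/
theorem exists_confined_stableLength_ge (hX : IsGeodesicSpace X) (hprop : IsProperAction G X)
    (hcontr : HasContractingProperty G X) {H : Subgroup G} {P : Set G}
    (hP : IsConfiningSubset H P) (hPE : Disjoint P (ellipticRadical G : Set G)) (o : X) :
    ∃ (S : Set G) (D : ℝ), S.Finite ∧ ∀ g : G, ∃ a ∈ S, ∃ b ∈ S, g * a * g⁻¹ * b ∈ H ∧
      2 * dist o (g • o) ≤ stableLength o (g * a * g⁻¹ * b) + D := by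
  -- The contracting property comes with its own basepoint.
  suffices hsuff : ∃ (o : X) (S : Set G) (D : ℝ), S.Finite ∧ ∀ g : G, ∃ a ∈ S, ∃ b ∈ S,
      g * a * g⁻¹ * b ∈ H ∧
      2 * dist o (g • o) ≤ stableLength o (g * a * g⁻¹ * b) + D by
    obtain ⟨o', S, D, hS, h⟩ := hsuff
    refine ⟨S, D + 4 * dist o o', hS, fun g => ?_⟩
    obtain ⟨a, ha, b, hb, hH, hle⟩ := h g
    refine ⟨a, ha, b, hb, hH, ?_⟩
    rw [stableLength_basepoint o o']
    have := dist_triangle4 o o' (g • o') (g • o)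
    rw [dist_smul, dist_comm o' o] at this
    linarith
  obtain ⟨o, f, v, hf, hv, hfv⟩ := hcontr
  refine ⟨o, ?_⟩
  replace hv := notMem_axisStabilizer hX hprop hf hv hfv
  obtain ⟨c, h⟩ := hf.exists_isBarrier hX hprop
  obtain ⟨T, hT, hcov⟩ := exists_finite_cover_axisStabilizer hX hprop hf
  obtain ⟨hPfin, -, hconf⟩ := hP
  obtain ⟨w, hw⟩ := h.exists_conj_notMem hv hPfin fun p hp hpN =>
    Set.disjoint_left.1 hPE hp (h.normalCore_le_ellipticRadical hv hT hcov hpN)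
  obtain ⟨k, K, hk⟩ := h.exists_extension hv
  obtain ⟨D₁, -, hD₁⟩ := exists_dist_smul_le o (hPfin.image fun p => w * p * w⁻¹)
  -- Conjugation by `f ^ n` shifts a projection lying within `2 * D₁ + 1 + c` of `o` by `f ^ n`, so
  -- it lands beyond `K + 4 * c`.
  obtain ⟨n, hn⟩ := exists_lt_dist_zpow h.finite one_ne_zero (K + 5 * c + (2 * D₁ + 1))
  rw [one_mul] at hn
  have hz : f ^ n ∈ axisStabilizer f := zpow_mem_axisStabilizer n
  set Q : Set G := (fun p => f ^ n * (w * p * w⁻¹) * (f ^ n)⁻¹) '' P with hQ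
  have hQfin : Q.Finite := hPfin.image _
  obtain ⟨D₂, -, hD₂⟩ := exists_dist_smul_le o hQfin
  obtain ⟨D₃, -, hD₃⟩ := exists_dist_smul_le o (Set.finite_range k)
  have hinv : ∀ g : G, dist o (g⁻¹ • o) = dist o (g • o) := fun g => by
    rw [← dist_smul_left_eq, dist_comm]
  have hQE : ∀ a ∈ Q, a ∉ axisStabilizer f := by
    rintro _ ⟨p, hp, rfl⟩
    rw [Subgroup.mul_mem_cancel_right _ (inv_mem hz), Subgroup.mul_mem_cancel_left _ hz]
    exact hw p hp
  have hfar : ∀ q : G, q ∉ axisStabilizer f → dist o (q • o) ≤ D₁ →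
      ∀ e ∈ proj (cyclicOrbit o f) ((f ^ n * q * (f ^ n)⁻¹) • o), K + 4 * c < dist o e := by
    intro q hq hqD e he
    obtain ⟨d, hd⟩ := proj_cyclicOrbit_nonempty o f (q • o)
    have h1 := dist_le_of_mem_proj_smul hd
    have h2 := h.bound hq (self_mem_cyclicOrbit o f) (zpow_smul_mem_cyclicOrbit o f (-n)) hd
      (q := f ^ (-n) • e) (by
        convert zpow_smul_mem_proj (-n) he using 2
        simp only [smul_smul]; congr 1; group)
    have h3 := dist_triangle4 o d (f ^ (-n) • e) (f ^ (-n) • o)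
    rw [dist_smul, zpow_neg, hinv, dist_comm e, ← zpow_neg] at h3
    linarith
  have hQ₁ : ∀ a ∈ Q, ∀ e ∈ proj (cyclicOrbit o f) (a • o), K + 4 * c < dist o e := by
    rintro _ ⟨p, hp, rfl⟩
    exact hfar _ (hw p hp) (hD₁ _ ⟨p, hp, rfl⟩)
  have hQ₂ : ∀ a ∈ Q, ∀ e ∈ proj (cyclicOrbit o f) (a⁻¹ • o),
      K + 4 * c < dist o e ∧ dist o e ≤ max K (2 * D₂ + 1) := by
    intro a ha e he
    refine ⟨?_, ?_⟩
    · obtain ⟨p, hp, rfl⟩ := ha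
      refine hfar (w * p * w⁻¹)⁻¹ (by rw [inv_mem_iff]; exact hw p hp)
        (by rw [hinv]; exact hD₁ _ ⟨p, hp, rfl⟩) e ?_
      convert he using 3
      group
    · have h1 := dist_le_of_mem_proj_smul he
      rw [hinv] at h1
      linarith [hD₂ a ha, le_max_right K (2 * D₂ + 1)]
  have hconf' : ∀ u : G, ∃ a ∈ Q, u * a * u⁻¹ ∈ H := by
    intro u
    obtain ⟨x, hxH, hx⟩ := hconf (u * f ^ n * w)⁻¹
    refine ⟨_, ⟨_, hx, rfl⟩, ?_⟩
    convert hxH using 1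
    group
  refine ⟨⋃ i : Fin 3, (fun a => k i * a * (k i)⁻¹) '' Q,
    4 * (2 * max K (2 * D₂ + 1) + 5 * c) + 4 * D₃,
    Set.finite_iUnion fun i => hQfin.image _, fun g => ?_⟩
  obtain ⟨i, j, htE, ht₁, ht₂⟩ := hk g
  -- The product of the two conjugates in `H` is conjugate by `k i` to `t * a * t⁻¹ * a'` with `t =
  -- (k i)⁻¹ * g * k j`.
  obtain ⟨a, ha, haH⟩ := hconf' (g * k j)
  obtain ⟨a', ha', haH'⟩ := hconf' (k i)
  refine ⟨_, Set.mem_iUnion.2 ⟨j, a, ha, rfl⟩, _, Set.mem_iUnion.2 ⟨i, a', ha', rfl⟩, ?_, ?_⟩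
  · convert mul_mem haH haH' using 1
    group
  · have h1 := h.le_stableLength_of_alternating (le_max_left K (2 * D₂ + 1)) htE (hQE a ha)
      (hQE a' ha') ht₁ ht₂ (hQ₁ a ha) (hQ₂ a ha) (hQ₁ a' ha') (hQ₂ a' ha')
    rw [← stableLength_conj o (k i)] at h1
    have e : k i * ((k i)⁻¹ * g * k j * a * ((k i)⁻¹ * g * k j)⁻¹ * a') * (k i)⁻¹ =
        g * (k j * a * (k j)⁻¹) * g⁻¹ * (k i * a' * (k i)⁻¹) := by group
    rw [e] at h1
    have h2 := dist_triangle4 o (k i • o) (g • k j • o) (g • o)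
    have h3 : dist (k i • o) (g • k j • o) = dist o (((k i)⁻¹ * g * k j) • o) := by
      rw [dist_smul_left_eq, mul_smul, mul_smul]
    rw [h3, dist_smul, dist_comm (k j • o)] at h2
    linarith [hD₃ (k i) ⟨i, rfl⟩, hD₃ (k j) ⟨j, rfl⟩]

/-- Stable lengths agreeing on a confined subgroup bound the displacements of one action by
those of the other. -/
theorem exists_dist_smul_le_add {X' : Type*} [MetricSpace X'] [MulAction G X']
    [IsIsometricSMul G X'] (hX : IsGeodesicSpace X) (hprop : IsProperAction G X)
    (hcontr : HasContractingProperty G X) {H : Subgroup G} {P : Set G}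
    (hP : IsConfiningSubset H P) (hPE : Disjoint P (ellipticRadical G : Set G)) (o : X) (o' : X')
    (hmls : ∀ h ∈ H, stableLength o h = stableLength o' h) :
    ∃ D : ℝ, ∀ g : G, dist o (g • o) ≤ dist o' (g • o') + D := by
  obtain ⟨S, D, hS, h⟩ := exists_confined_stableLength_ge hX hprop hcontr hP hPE o
  obtain ⟨D', -, hD'⟩ := exists_dist_smul_le o' hS
  refine ⟨D' + D / 2, fun g => ?_⟩
  obtain ⟨a, ha, b, hb, hH, hle⟩ := h g
  rw [hmls _ hH] at hle
  have h1 := stableLength_le_dist o' (g * a * g⁻¹ * b)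
  have h2 := dist_triangle4 o' (g • o') (g • a • o') (g • a • g⁻¹ • o')
  have h3 := dist_triangle o' (g • a • g⁻¹ • o') (g • a • g⁻¹ • b • o')
  simp only [mul_smul, dist_smul] at h1 h2 h3
  rw [← dist_smul_left_eq, dist_comm (g • o')] at h2
  linarith [hD' a ha, hD' b hb]

end Confined

end MLS

/-! ### Comparison of the two actions -/

theorem theorem1p7 {G X₁ X₂ : Type*} [Group G]
    [MetricSpace X₁] [MulAction G X₁] [IsIsometricSMul G X₁]
    [MetricSpace X₂] [MulAction G X₂] [IsIsometricSMul G X₂]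
    (hX₁ : MLS.IsGeodesicSpace X₁) (hX₂ : MLS.IsGeodesicSpace X₂)
    (hproper₁ : MLS.IsProperAction G X₁) (hproper₂ : MLS.IsProperAction G X₂)
    (hcontr₁ : MLS.HasContractingProperty G X₁) (hcontr₂ : MLS.HasContractingProperty G X₂)
    (H : Subgroup G) (P : Set G) (hP : MLS.IsConfiningSubset H P)
    (hPE : Disjoint P (MLS.ellipticRadical G : Set G))
    (o₁ : X₁) (o₂ : X₂)
    (hmls : ∀ h ∈ H, MLS.stableLength o₁ h = MLS.stableLength o₂ h) :
    (∃ C : ℝ, ∀ g h : G,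
      |dist (g • o₁) (h • o₁) - dist (g • o₂) (h • o₂)| ≤ C) ∧
    ∀ ρ : MulAction.orbit G o₁ → MulAction.orbit G o₂,
      MLS.IsOrbitMap ρ → MLS.IsRoughIsometry ρ := by
  obtain ⟨D₁, hD₁⟩ :=
    MLS.exists_dist_smul_le_add hX₁ hproper₁ hcontr₁ hP hPE o₁ o₂ hmls
  obtain ⟨D₂, hD₂⟩ :=
    MLS.exists_dist_smul_le_add hX₂ hproper₂ hcontr₂ hP hPE o₂ o₁ fun h hh => (hmls h hh).symm
  have hC : ∀ g h : G,
      |dist (g • o₁) (h • o₁) - dist (g • o₂) (h • o₂)| ≤ max D₁ D₂ := by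
    intro g h
    have e₁ : dist (g • o₁) (h • o₁) = dist o₁ ((g⁻¹ * h) • o₁) := by
      rw [MLS.dist_smul_left_eq, mul_smul]
    have e₂ : dist (g • o₂) (h • o₂) = dist o₂ ((g⁻¹ * h) • o₂) := by
      rw [MLS.dist_smul_left_eq, mul_smul]
    rw [e₁, e₂, abs_le]
    constructor
    · linarith [hD₂ (g⁻¹ * h), le_max_right D₁ D₂]
    · linarith [hD₁ (g⁻¹ * h), le_max_left D₁ D₂]
  exact ⟨⟨_, hC⟩, fun ρ hρ => hρ.isRoughIsometry hC⟩
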